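/- Let $\mu$ be a Borel probability measure on $\mathbb{R}^d$ with finite second moment. Let $C_X$ be the set of maps $X:\mathbb{R}^d\times[0,1]\to\mathbb{R}^d$ in $H^1(0,1;L^2(\mu))$ with $X(x,0)=x$; for such $X$ the trajectory $X(x,\cdot)$ is absolutely continuous for $\mu$-a.e. $x$, with weak time derivative $\partial_tX\in L^2(\mu\otimes[0,1])$. Let $F,G:\mathbb{R}^d\to\mathbb{R}$ be $L$-smooth (differentiable with $L$-Lipschitz gradient), let $0<\alpha<1/L$, and for $X,Y\in C_X$ put $$\mathcal J(X)=\int\Big[\int_0^1\Big(\tfrac12\|\partial_tX(x,t)\|^2+F(X(x,t))\Big)\,dt+G(X(x,1))\Big]d\mu(x),$$ $$D(X,Y)=\int_0^1\!\!\int\|X(x,t)-Y(x,t)\|^2\,d\mu(x)\,dt+\int\|X(x,1)-Y(x,1)\|^2\,d\mu(x).$$ Let $C_v$ be the set of Borel fields $v:\mathbb{R}^d\times[0,1]\to\mathbb{R}^d$ that, on every compact $B\subset\mathbb{R}^d$, are bounded and Lipschitz continuous in $x$, uniformly in $t\in[0,1]$. (i) Suppose that, for every $\ell\ge0$: $v^{(\ell)}\in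 C_v$; $X^{(\ell)}\in C_X$ satisfies $\partial_tX^{(\ell)}(x,t)=v^{(\ell)}(X^{(\ell)}(x,t),t)$ for $\mu$-a.e. $x$ and a.e. $t$; $X^{(\ell+1/2)}$ minimizes $X\mapsto\mathcal J(X)+\frac1{2\alpha}D(X,X^{(\ell)})$ over $C_X$; and $v^{(\ell+1)}$ minimizes $$v\mapsto\int_0^1\!\!\int\big\|v(X^{(\ell+1/2)}(x,t),t)-\partial_tX^{(\ell+1/2)}(x,t)\big\|^2\,d\mu(x)\,dt$$ over all Borel fields $v:\mathbb{R}^d\times[0,1]\to\mathbb{R}^d$. Suppose also that $\mathcal J(X)\ge\underline{\mathcal J}$ for all $X\in C_X$, with $\underline{\mathcal J}\in\mathbb{R}$. Then for every integer $K\ge1$ $$\min_{0\le\ell\le K}D(X^{(\ell+1/2)},X^{(\ell)})\le\frac{2\alpha\,(\mathcal J(X^{(0)})-\underline{\mathcal J})}{K}.$$ (ii) Suppose that $F$ and $G$ are $\lambda$-convex for some $\lambda>0$ (that is, $F-\frac\lambda2\|\cdot\|^2$ and $G-\frac\lambda2\|\cdot\|^2$ are convex), and that $X^*$ minimizes $\mathcal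 J$ over $C_X$. Let $X^{(0)}\in C_X$ and, for each $\ell\ge0$, let $X^{(\ell+1)}$ minimize $X\mapsto\mathcal J(X)+\frac1{2\alpha}D(X,X^{(\ell)})$ over $C_X$. Then for every $\ell\ge0$ $$D(X^{(\ell)},X^*)\le\frac{1}{(1+2\lambda\alpha)^{\ell}}\,D(X^{(0)},X^*).$$ -/

import Mathlib

open MeasureTheory Set

noncomputable section

/-- The state space `ℝ^d` with its Euclidean norm. -/
abbrev RR (d : ℕ) : Type := EuclideanSpace ℝ (Fin d)

/-- The set `C_X` of characteristic maps `X : ℝ^d × [0,1] → ℝ^d`: the elements of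
`H¹(0,1; L²(μ))` with `X(x,0) = x`.  Such an `X` is recorded by its representative with
absolutely continuous trajectories, together with (a representative of) its weak time derivative
`vel = ∂ₜX ∈ L²(μ ⊗ [0,1])`, so that `X(x,t) = x + ∫₀ᵗ ∂ₜX(x,s) ds` for `μ`-a.e. `x` and all
`t ∈ [0,1]`.  The map determines `vel` up to null sets, see `CharMap.vel_unique`.  Values at times
outside `[0,1]` play no role. -/
structure CharMap {d : ℕ} (μ : Measure (RR d)) where
  /-- the map `(x, t) ↦ X(x,t)` -/
  map : RR d → ℝ → RR d
  /-- the weak time derivative `(x, t) ↦ ∂ₜX(x,t)` -/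
  vel : RR d → ℝ → RR d
  memLp_vel : MemLp (Function.uncurry vel) 2 (μ.prod (volume.restrict (Icc (0 : ℝ) 1)))
  map_eq : ∀ᵐ x ∂μ, ∀ t ∈ Icc (0 : ℝ) 1, map x t = x + ∫ s in (0 : ℝ)..t, vel x s

/-- The weak time derivative is determined almost everywhere by the map. -/
theorem CharMap.vel_unique {d : ℕ} {μ : Measure (RR d)} [IsProbabilityMeasure μ]
    (X Y : CharMap μ)
    (h : ∀ᵐ x ∂μ, ∀ t ∈ Icc (0 : ℝ) 1, X.map x t = Y.map x t) :
    Function.uncurry X.vel =ᵐ[μ.prod (volume.restrict (Icc (0 : ℝ) 1))]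
      Function.uncurry Y.vel := by
  have hX := X.memLp_vel.integrable (by norm_num)
  have hY := Y.memLp_vel.integrable (by norm_num)
  have hD := hX.sub hY
  have key : ∀ᵐ x ∂μ, ∀ᵐ t ∂(volume.restrict (Icc (0 : ℝ) 1)), X.vel x t - Y.vel x t = 0 := by
    filter_upwards [h, X.map_eq, Y.map_eq, hX.prod_right_ae, hY.prod_right_ae]
      with x hx hx1 hx2 hi1 hi2
    have j1 : IntervalIntegrable (X.vel x) volume 0 1 :=
      (intervalIntegrable_iff_integrableOn_Icc_of_le zero_le_one).2 hi1
    have j2 : IntervalIntegrable (Y.vel x) volume 0 1 :=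
      (intervalIntegrable_iff_integrableOn_Icc_of_le zero_le_one).2 hi2
    have hz : ∀ t ∈ Icc (0 : ℝ) 1, ∫ s in (0 : ℝ)..t, (X.vel x s - Y.vel x s) = 0 := by
      intro t ht
      have hsub : uIcc (0 : ℝ) t ⊆ uIcc 0 1 := by
        rw [uIcc_of_le ht.1, uIcc_of_le zero_le_one]
        exact Icc_subset_Icc_right ht.2
      rw [intervalIntegral.integral_sub (j1.mono_set hsub) (j2.mono_set hsub), sub_eq_zero]
      have := hx t ht
      rw [hx1 t ht, hx2 t ht] at this
      exact add_left_cancel this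
    have hder := (j1.sub j2).ae_hasDerivAt_integral
    rw [← Measure.restrict_congr_set (Ioo_ae_eq_Icc (a := (0 : ℝ)) (b := 1)),
      ae_restrict_iff' measurableSet_Ioo]
    filter_upwards [hder] with t ht htI
    have hm : t ∈ uIcc (0 : ℝ) 1 := by
      rw [uIcc_of_le zero_le_one]; exact Ioo_subset_Icc_self htI
    have d1 := ht hm 0 (by simp)
    have d2 : HasDerivAt (fun u => ∫ s in (0 : ℝ)..u, (X.vel x s - Y.vel x s)) 0 t := by
      refine (hasDerivAt_const t (0 : RR d)).congr_of_eventuallyEq ?_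
      filter_upwards [Ioo_mem_nhds htI.1 htI.2] with u hu
      exact hz u (Ioo_subset_Icc_self hu)
    exact d1.unique d2
  have hnull : (fun p : RR d × ℝ => ‖(Function.uncurry X.vel - Function.uncurry Y.vel) p‖ₑ)
      =ᵐ[μ.prod (volume.restrict (Icc (0 : ℝ) 1))] 0 := by
    rw [← lintegral_eq_zero_iff' hD.aestronglyMeasurable.enorm,
      lintegral_prod _ hD.aestronglyMeasurable.enorm]
    rw [lintegral_congr_ae (g := fun _ => 0), lintegral_zero]
    filter_upwards [key] with x hx
    rw [lintegral_congr_ae (g := fun _ => 0), lintegral_zero]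
    filter_upwards [hx] with t ht
    simp [Function.uncurry, ht]
  filter_upwards [hnull] with p hp
  simpa [sub_eq_zero] using hp

/-- The set `C_v`: Borel velocity fields `v(x,t)` that are bounded and Lipschitz continuous in `x`
on every compact set `B ⊆ ℝ^d` (uniformly in `t ∈ [0,1]`). -/
def IsRegularField {d : ℕ} (v : RR d → ℝ → RR d) : Prop :=
  Measurable (Function.uncurry v) ∧
    ∀ B : Set (RR d), IsCompact B →
      (∃ M : ℝ, ∀ t ∈ Icc (0 : ℝ) 1, ∀ x ∈ B, ‖v x t‖ ≤ M) ∧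
      (∃ K : NNReal, ∀ t ∈ Icc (0 : ℝ) 1, LipschitzOnWith K (fun x => v x t) B)

/-- The constraint `(X, v) ∈ C_{(X,v)}`: the ODE `∂ₜX(x,t) = v(X(x,t),t)` holds for
`μ`-a.e. `x` and a.e. `t ∈ [0,1]`; the initial condition `X(x,0) = x` is part of `CharMap`. -/
def SolvesODE {d : ℕ} {μ : Measure (RR d)} (X : CharMap μ) (v : RR d → ℝ → RR d) : Prop :=
  ∀ᵐ x ∂μ, ∀ᵐ t ∂(volume.restrict (Icc (0 : ℝ) 1)), X.vel x t = v (X.map x t) t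

/-- The control objective
`J(X) = E_{x∼μ} [ ∫₀¹ (½ ‖∂ₜX(x,t)‖² + F(X(x,t))) dt + G(X(x,1)) ]`. -/
def cost {d : ℕ} {μ : Measure (RR d)} (F G : RR d → ℝ) (X : CharMap μ) : ℝ :=
  ∫ x, ((∫ t in (0 : ℝ)..1, (1 / 2 * ‖X.vel x t‖ ^ 2 + F (X.map x t))) + G (X.map x 1)) ∂μ

/-- The squared distance `‖X - Y‖²_{μ⊗[0,1]} + ‖X₁ - Y₁‖²_μ`. -/
def distSq {d : ℕ} {μ : Measure (RR d)} (X Y : CharMap μ) : ℝ :=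
  (∫ t in (0 : ℝ)..1, ∫ x, ‖X.map x t - Y.map x t‖ ^ 2 ∂μ) + ∫ x, ‖X.map x 1 - Y.map x 1‖ ^ 2 ∂μ

/-- `X'` is a minimizer over `C_X` of `Z ↦ J(Z) + (1/2α) (‖Z - X‖²_{μ⊗[0,1]} + ‖Z₁ - X₁‖²_μ)`. -/
def IsParticleUpdate {d : ℕ} {μ : Measure (RR d)} (F G : RR d → ℝ) (α : ℝ)
    (X X' : CharMap μ) : Prop :=
  ∀ Z : CharMap μ,
    cost F G X' + 1 / (2 * α) * distSq X' X ≤ cost F G Z + 1 / (2 * α) * distSq Z X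

/-- The flow matching loss `∫₀¹ ∫ ‖v(X(x,t),t) - ∂ₜX(x,t)‖² dμ(x) dt`, with value in `[0,∞]`. -/
def matchingLoss {d : ℕ} {μ : Measure (RR d)} (X : CharMap μ) (v : RR d → ℝ → RR d) : ENNReal :=
  ∫⁻ t in Icc (0 : ℝ) 1, ∫⁻ x, ‖v (X.map x t) t - X.vel x t‖ₑ ^ 2 ∂μ

/-- `v` minimizes the flow matching loss of `X` among all Borel velocity fields. -/
def IsFlowMatching {d : ℕ} {μ : Measure (RR d)} (X : CharMap μ) (v : RR d → ℝ → RR d) : Prop :=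
  Measurable (Function.uncurry v) ∧
    ∀ w : RR d → ℝ → RR d, Measurable (Function.uncurry w) → matchingLoss X v ≤ matchingLoss X w

/-- `X ℓ = X^{(ℓ)}`, `Xh ℓ = X^{(ℓ+1/2)}` and `v ℓ = v^{(ℓ)}` are generated by the proximal scheme
with constant step size `α`: resampling, particle update and flow matching update. -/
structure IsSchemeSequence {d : ℕ} {μ : Measure (RR d)} (F G : RR d → ℝ) (α : ℝ)
    (X Xh : ℕ → CharMap μ) (v : ℕ → RR d → ℝ → RR d) : Prop where
  resample : ∀ l, SolvesODE (X l) (v l)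
  particle : ∀ l, IsParticleUpdate F G α (X l) (Xh l)
  flowMatching : ∀ l, IsFlowMatching (Xh l) (v (l + 1))

/-- `L`-smoothness on `ℝ^d`: differentiable with `L`-Lipschitz gradient. -/
def IsLSmooth {d : ℕ} (L : NNReal) (f : RR d → ℝ) : Prop :=
  Differentiable ℝ f ∧ LipschitzWith L (gradient f)

end

/-!
# Convergence of the proximal flow matching scheme

**Convex case.** On the segment `(1 - s) A + s B` between characteristic maps, `distSq` satisfies
the parallelogram identity (`distSq_lerp`) and the cost is `lam`-strongly convex with respect to
`distSq` (`cost_lerp_le`). A minimizer of a strongly convex functional beats every competitor by the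
quadratic margin; this is applied to the proximal functional at the update and to the cost at its
minimizer, and the sum of the two inequalities is the contraction
`(1 + 2 * lam * α) * distSq X' Xs ≤ distSq X Xs` (`IsParticleUpdate.contraction`).

**General case.** The particle update lowers the cost by at least `distSq / (2 * α)`, since the
previous iterate is a competitor. The sum over the steps telescopes, provided that flow matching and
resampling do not increase the cost (`cost_le_of_isFlowMatching`). Let `Y` be the updated map,
`v` its matched field and `X` the resampled flow of `v`. The first variation of the matching loss
says that `v(Y, t)` is the `L²` projection of `∂ₜY` onto the functions of `(Y, t)`
(`IsFlowMatching.isWeakDrift`). Hence `v(Y, t)` has at most the kinetic energy of `Y`, and the laws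
of `Y(·, t)` and of `X(·, t)` both solve the continuity equation with velocity `v`. If these
laws agree (`IsWeakDrift.map_eq`), then `X` and `Y` have the same potential and terminal costs, and the
kinetic energy of `X` is that of `v(Y, t)`.

**Uniqueness for the continuity equation** is proved by duality. A test function `ψ` at time `T` is
transported backwards along a globally bounded and Lipschitz truncation `w` of `v`, by an explicit
Euler scheme with spatially mollified displacements: `u ↦ u ∘ (id + s)`. The gradients of the
transported functions stay bounded independently of the step size and of the mollification scale
`ε`; the Lipschitz constants of the gradients are bounded independently of the step size only. The
expectation of `χ u`, with a cutoff `χ` at radius `R`, then changes along a trajectory by an error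
that vanishes as the step size and then `ε` tend to zero, plus a term of order `1 / R` that comes
from the gradient of `χ` and the integrability of `v` along the trajectory
(`IsWeakDrift.abs_sub_le_of_step`, `IsWeakDrift.abs_integral_cutoff_sub_le`). Both maps start
from `μ`, so `R → ∞` gives equal expectations of `ψ`; cosines suffice, by characteristic functions.
-/

/-! ### Integrability of characteristic maps -/

/-- The product of the initial law with Lebesgue measure on the time interval `[0,1]`. -/
noncomputable abbrev timeProd {d : ℕ} (μ : Measure (RR d)) : Measure (RR d × ℝ) :=
  μ.prod (volume.restrict (Icc (0 : ℝ) 1))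

/-- The Cauchy–Schwarz inequality in time. -/
theorem sq_integral_norm_le {E : Type*} [NormedAddCommGroup E] {f : ℝ → E} {a b : ℝ}
    (hab : a ≤ b) (hf : MemLp f 2 (volume.restrict (Ioc a b))) :
    (∫ s in Ioc a b, ‖f s‖) ^ 2 ≤ (b - a) * ∫ s in Ioc a b, ‖f s‖ ^ 2 := by
  have hf1 : Integrable (fun s => ‖f s‖) (volume.restrict (Ioc a b)) :=
    (hf.integrable (by norm_num)).norm
  have hf2 : Integrable (fun s => ‖f s‖ ^ 2) (volume.restrict (Ioc a b)) :=
    hf.integrable_norm_pow (by norm_num)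
  set A := ∫ s in Ioc a b, ‖f s‖
  set B := ∫ s in Ioc a b, ‖f s‖ ^ 2
  have key : ∀ c : ℝ, 0 ≤ B * 1 - 2 * c * A + c ^ 2 * (b - a) := by
    intro c
    have h : ∫ s in Ioc a b, (‖f s‖ - c) ^ 2 = B * 1 - 2 * c * A + c ^ 2 * (b - a) := by
      have : (fun s => (‖f s‖ - c) ^ 2) = fun s => ‖f s‖ ^ 2 - 2 * c * ‖f s‖ + c ^ 2 := by
        ext s; ring
      rw [this, integral_add (f := fun s => ‖f s‖ ^ 2 - 2 * c * ‖f s‖) (g := fun _ => c ^ 2)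
          (hf2.sub (hf1.const_mul _)) (integrable_const _),
        integral_sub hf2 (hf1.const_mul _), integral_const_mul]
      simp [A, B, hab, mul_comm]
    rw [← h]; exact integral_nonneg fun _ => sq_nonneg _
  rcases hab.eq_or_lt with h | h
  · subst h; simp [A]
  · have := key (A / (b - a))
    have hpos : 0 < b - a := sub_pos.2 h
    have e : B * 1 - 2 * (A / (b - a)) * A + (A / (b - a)) ^ 2 * (b - a)
        = ((b - a) * B - A ^ 2) / (b - a) := by field_simp; ring
    rw [e] at this
    have := (div_nonneg_iff.1 this)
    rcases this with h' | h'
    · linarith [h'.1]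
    · linarith [h'.2]

namespace CharMap

variable {d : ℕ} {μ : Measure (RR d)}

theorem ae_time_mem : ∀ᵐ p ∂(timeProd μ), p.2 ∈ Icc (0 : ℝ) 1 :=
  Measure.quasiMeasurePreserving_snd.ae (ae_restrict_mem measurableSet_Icc)

theorem aestronglyMeasurable_map_time (X : CharMap μ) {t : ℝ} (ht : t ∈ Icc (0 : ℝ) 1) :
    AEStronglyMeasurable (fun x => X.map x t) μ := by
  have h1 : AEStronglyMeasurable (fun x => x + ∫ s in Ioc (0 : ℝ) t, X.vel x s) μ := by
    refine AEStronglyMeasurable.add aestronglyMeasurable_id ?_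
    refine AEStronglyMeasurable.integral_prod_right' (f := Function.uncurry X.vel) ?_
    refine X.memLp_vel.1.mono_measure ?_
    refine Measure.prod_mono le_rfl (Measure.restrict_mono_set _ ?_)
    exact Ioc_subset_Icc_self.trans (Icc_subset_Icc_right ht.2)
  refine h1.congr ?_
  filter_upwards [X.map_eq] with x hx
  rw [hx t ht, intervalIntegral.integral_of_le ht.1]

theorem aestronglyMeasurable_map (X : CharMap μ) :
    AEStronglyMeasurable (Function.uncurry X.map) (timeProd μ) := by
  let V := X.memLp_vel.1.mk _
  have hV : StronglyMeasurable V := X.memLp_vel.1.stronglyMeasurable_mk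
  have hVe : Function.uncurry X.vel =ᵐ[timeProd μ] V := X.memLp_vel.1.ae_eq_mk
  let W : RR d × ℝ → RR d := fun p =>
    p.1 + ∫ s in Icc (0 : ℝ) 1, (Ioc 0 p.2).indicator (fun s => V (p.1, s)) s
  have hW : StronglyMeasurable W := by
    refine measurable_fst.stronglyMeasurable.add ?_
    refine StronglyMeasurable.integral_prod_right'
      (f := fun q : (RR d × ℝ) × ℝ => (Ioc 0 q.1.2).indicator (fun s => V (q.1.1, s)) q.2) ?_
    have : (fun q : (RR d × ℝ) × ℝ => (Ioc 0 q.1.2).indicator (fun s => V (q.1.1, s)) q.2)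
        = {q : (RR d × ℝ) × ℝ | 0 < q.2 ∧ q.2 ≤ q.1.2}.indicator
          (fun q => V (q.1.1, q.2)) := by
      ext1 q; simp only [indicator, mem_Ioc, mem_ofPred_eq]
    rw [this]
    refine StronglyMeasurable.indicator ?_ ?_
    · exact hV.comp_measurable (by fun_prop)
    · exact (measurableSet_lt measurable_const measurable_snd).inter
        (measurableSet_le measurable_snd (by fun_prop))
  refine hW.aestronglyMeasurable.congr ?_
  have hx1 : ∀ᵐ x ∂μ, ∀ t ∈ Icc (0 : ℝ) 1, W (x, t) = X.map x t := by
    filter_upwards [X.map_eq, Measure.ae_ae_of_ae_prod hVe] with x hx hv t ht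
    rw [hx t ht, intervalIntegral.integral_of_le ht.1]
    simp only [W]
    congr 1
    rw [setIntegral_indicator measurableSet_Ioc,
      inter_eq_right.2 (Ioc_subset_Icc_self.trans (Icc_subset_Icc_right ht.2))]
    refine integral_congr_ae ?_
    have hsub : Ioc 0 t ⊆ Icc (0 : ℝ) 1 :=
      Ioc_subset_Icc_self.trans (Icc_subset_Icc_right ht.2)
    filter_upwards [ae_mono (Measure.restrict_mono_set volume hsub) hv] with s hs
    exact hs.symm
  have h3 : ∀ᵐ p ∂(timeProd μ), ∀ t ∈ Icc (0 : ℝ) 1, W (p.1, t) = X.map p.1 t :=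
    Measure.quasiMeasurePreserving_fst.ae hx1
  have h4 : ∀ᵐ p ∂(timeProd μ), p.2 ∈ Icc (0 : ℝ) 1 :=
    Measure.quasiMeasurePreserving_snd.ae (ae_restrict_mem measurableSet_Icc)
  filter_upwards [h3, h4] with p hp hp2
  exact hp p.2 hp2

variable [IsProbabilityMeasure μ]

theorem ae_memLp_vel (X : CharMap μ) :
    ∀ᵐ x ∂μ, MemLp (X.vel x) 2 (volume.restrict (Icc (0 : ℝ) 1)) := by
  have h1 := X.memLp_vel.1.prodMk_left
  have h2 := (X.memLp_vel.integrable_norm_pow (by norm_num)).prod_right_ae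
  filter_upwards [h1, h2] with x hx1 hx2
  exact (memLp_two_iff_integrable_sq_norm hx1).2 hx2

theorem ae_integrable_vel (X : CharMap μ) :
    ∀ᵐ x ∂μ, IntegrableOn (X.vel x) (Icc (0 : ℝ) 1) := by
  filter_upwards [X.ae_memLp_vel] with x hx
  exact hx.integrable (by norm_num)

theorem ae_intervalIntegrable_vel (X : CharMap μ) :
    ∀ᵐ x ∂μ, ∀ a ∈ Icc (0 : ℝ) 1, ∀ b ∈ Icc (0 : ℝ) 1,
      IntervalIntegrable (X.vel x) volume a b := by
  filter_upwards [X.ae_integrable_vel] with x hx a ha b hb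
  rw [intervalIntegrable_iff]
  refine hx.mono_set ?_
  exact uIoc_subset_uIcc.trans (uIcc_subset_Icc ha hb)

theorem ae_map_sub (X : CharMap μ) :
    ∀ᵐ x ∂μ, ∀ a ∈ Icc (0 : ℝ) 1, ∀ b ∈ Icc (0 : ℝ) 1,
      X.map x b - X.map x a = ∫ s in a..b, X.vel x s := by
  filter_upwards [X.ae_intervalIntegrable_vel, X.map_eq] with x hi hx a ha b hb
  have h0 : (0 : ℝ) ∈ Icc (0 : ℝ) 1 := ⟨le_rfl, zero_le_one⟩
  rw [hx a ha, hx b hb, ← intervalIntegral.integral_add_adjacent_intervals (hi 0 h0 a ha)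
    (hi a ha b hb)]
  abel

/-- The pathwise bound `‖x‖ + ∫₀¹ ‖∂ₜX(x,s)‖ ds` on a trajectory. -/
noncomputable def bound (X : CharMap μ) (x : RR d) : ℝ :=
  ‖x‖ + ∫ s in Icc (0 : ℝ) 1, ‖X.vel x s‖

theorem ae_norm_map_le (X : CharMap μ) :
    ∀ᵐ x ∂μ, ∀ t ∈ Icc (0 : ℝ) 1, ‖X.map x t‖ ≤ X.bound x := by
  filter_upwards [X.ae_integrable_vel, X.map_eq] with x hi hx t ht
  rw [hx t ht, bound]
  refine (norm_add_le _ _).trans (add_le_add le_rfl ?_)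
  refine (intervalIntegral.norm_integral_le_integral_norm ht.1).trans ?_
  rw [intervalIntegral.integral_of_le ht.1]
  refine setIntegral_mono_set hi.norm (ae_of_all _ fun _ => norm_nonneg _) ?_
  exact (Ioc_subset_Icc_self.trans (Icc_subset_Icc_right ht.2)).eventuallyLE

theorem memLp_bound (hμ : MemLp (fun x : RR d => x) 2 μ) (X : CharMap μ) :
    MemLp X.bound 2 μ := by
  refine MemLp.add hμ.norm ?_
  have hm : AEStronglyMeasurable (fun x => ∫ s in Icc (0 : ℝ) 1, ‖X.vel x s‖) μ :=
    X.memLp_vel.1.norm.integral_prod_right'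
  refine (memLp_two_iff_integrable_sq hm).2 ?_
  have h2 := (X.memLp_vel.integrable_norm_pow (by norm_num)).integral_prod_left
  refine h2.mono' (hm.pow 2) ?_
  filter_upwards [X.ae_memLp_vel] with x hx
  rw [← Measure.restrict_congr_set (Ioc_ae_eq_Icc (a := (0 : ℝ)) (b := 1))] at hx
  have := sq_integral_norm_le zero_le_one hx
  rw [Real.norm_of_nonneg (sq_nonneg _)]
  simpa [integral_Icc_eq_integral_Ioc] using this

theorem memLp_map (hμ : MemLp (fun x : RR d => x) 2 μ) (X : CharMap μ) :
    MemLp (Function.uncurry X.map) 2 (timeProd μ) := by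
  have hb : MemLp (fun p : RR d × ℝ => X.bound p.1) 2 (timeProd μ) :=
    (X.memLp_bound hμ).comp_fst _
  refine hb.of_le X.aestronglyMeasurable_map ?_
  filter_upwards [Measure.quasiMeasurePreserving_fst.ae X.ae_norm_map_le, ae_time_mem]
    with p hp hp2
  exact (hp p.2 hp2).trans (le_abs_self _)

theorem memLp_map_time (hμ : MemLp (fun x : RR d => x) 2 μ) (X : CharMap μ) {t : ℝ}
    (ht : t ∈ Icc (0 : ℝ) 1) : MemLp (fun x => X.map x t) 2 μ := by
  refine (X.memLp_bound hμ).of_le (X.aestronglyMeasurable_map_time ht) ?_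
  filter_upwards [X.ae_norm_map_le] with x hx
  exact (hx t ht).trans (le_abs_self _)

end CharMap

/-! ### The cost and the squared distance as space-time integrals -/

section Integrals

variable {d : ℕ} {μ : Measure (RR d)}

theorem distSq_nonneg (X Y : CharMap μ) : 0 ≤ distSq X Y := by
  refine add_nonneg ?_ (integral_nonneg fun _ => sq_nonneg _)
  exact intervalIntegral.integral_nonneg zero_le_one fun _ _ =>
    integral_nonneg fun _ => sq_nonneg _

theorem distSq_self (X : CharMap μ) : distSq X X = 0 := by
  simp [distSq]

theorem distSq_comm (X Y : CharMap μ) : distSq X Y = distSq Y X := by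
  simp only [distSq, norm_sub_rev]

theorem IsLSmooth.abs_le {L : NNReal} {f : RR d → ℝ} (hf : IsLSmooth L f) (x : RR d) :
    |f x| ≤ |f 0| + ‖gradient f 0‖ * ‖x‖ + L * ‖x‖ ^ 2 := by
  have h1 : ∀ y ∈ Metric.closedBall (0 : RR d) ‖x‖,
      ‖fderiv ℝ f y‖ ≤ ‖gradient f 0‖ + L * ‖x‖ := by
    intro y hy
    have h2 : ‖fderiv ℝ f y‖ = ‖gradient f y‖ := by
      rw [gradient, LinearIsometryEquiv.norm_map]
    have h3 := hf.2.dist_le_mul y 0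
    rw [dist_eq_norm, dist_eq_norm, sub_zero] at h3
    have h4 : ‖y‖ ≤ ‖x‖ := by simpa using hy
    calc ‖fderiv ℝ f y‖ = ‖gradient f y‖ := h2
      _ ≤ ‖gradient f 0‖ + ‖gradient f y - gradient f 0‖ := by
        simpa using norm_add_le (gradient f 0) (gradient f y - gradient f 0)
      _ ≤ _ := by gcongr; exact h3.trans (by gcongr)
  have h5 := (convex_closedBall (0 : RR d) ‖x‖).norm_image_sub_le_of_norm_fderiv_le
    (𝕜 := ℝ) (fun y _ => hf.1 y) h1 (x := 0) (y := x) (by simp) (by simp)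
  rw [sub_zero, Real.norm_eq_abs] at h5
  have h6 : |f x| ≤ |f 0| + |f x - f 0| := by simpa using abs_add_le (f 0) (f x - f 0)
  nlinarith

theorem IsLSmooth.integrable_comp {Ω : Type*} [MeasurableSpace Ω] {P : Measure Ω}
    [IsFiniteMeasure P] {L : NNReal} {f : RR d → ℝ} (hf : IsLSmooth L f) {g : Ω → RR d}
    (hg : MemLp g 2 P) : Integrable (fun ω => f (g ω)) P := by
  have h1 := hg.integrable_norm_pow (by norm_num)
  have h2 := (hg.integrable (by norm_num)).norm
  refine (((integrable_const (|f 0|)).add (h2.const_mul ‖gradient f 0‖)).add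
    (h1.const_mul (L : ℝ))).mono' (hf.1.continuous.comp_aestronglyMeasurable hg.1) ?_
  exact ae_of_all _ fun ω => hf.abs_le (g ω)

variable [IsProbabilityMeasure μ]

/-- The iterated integrals in `cost` separate: each term is integrable because `F` and `G` grow at
most quadratically and `X` is square integrable. -/
theorem cost_eq (hμ : MemLp (fun x : RR d => x) 2 μ) {F G : RR d → ℝ} {L : NNReal}
    (hF : IsLSmooth L F) (hG : IsLSmooth L G) (X : CharMap μ) :
    cost F G X = 1 / 2 * (∫ p, ‖X.vel p.1 p.2‖ ^ 2 ∂(timeProd μ))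
      + (∫ p, F (X.map p.1 p.2) ∂(timeProd μ)) + ∫ x, G (X.map x 1) ∂μ := by
  have hv : Integrable (fun p : RR d × ℝ => ‖X.vel p.1 p.2‖ ^ 2) (timeProd μ) :=
    X.memLp_vel.integrable_norm_pow (by norm_num)
  have hf : Integrable (fun p : RR d × ℝ => F (X.map p.1 p.2)) (timeProd μ) :=
    hF.integrable_comp (X.memLp_map hμ)
  have hg : Integrable (fun x => G (X.map x 1)) μ :=
    hG.integrable_comp (X.memLp_map_time hμ ⟨zero_le_one, le_rfl⟩)
  have hs : Integrable
      (fun p : RR d × ℝ => 1 / 2 * ‖X.vel p.1 p.2‖ ^ 2 + F (X.map p.1 p.2)) (timeProd μ) :=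
    (hv.const_mul (1 / 2)).add hf
  rw [cost, integral_add _ hg]
  · congr 1
    rw [← integral_const_mul, ← integral_add (hv.const_mul _) hf, integral_prod _ hs]
    refine integral_congr_ae (ae_of_all _ fun x => ?_)
    simp only [intervalIntegral.integral_of_le zero_le_one, integral_Icc_eq_integral_Ioc]
  · refine hs.integral_prod_left.congr (ae_of_all _ fun x => ?_)
    simp only [intervalIntegral.integral_of_le zero_le_one, integral_Icc_eq_integral_Ioc]

theorem integrable_dist_sq (hμ : MemLp (fun x : RR d => x) 2 μ) (X Y : CharMap μ) :
    Integrable (fun p : RR d × ℝ => ‖X.map p.1 p.2 - Y.map p.1 p.2‖ ^ 2) (timeProd μ) :=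
  ((X.memLp_map hμ).sub (Y.memLp_map hμ)).integrable_norm_pow (by norm_num)

theorem integrable_dist_sq_one (hμ : MemLp (fun x : RR d => x) 2 μ) (X Y : CharMap μ) :
    Integrable (fun x => ‖X.map x 1 - Y.map x 1‖ ^ 2) μ :=
  ((X.memLp_map_time hμ ⟨zero_le_one, le_rfl⟩).sub
    (Y.memLp_map_time hμ ⟨zero_le_one, le_rfl⟩)).integrable_norm_pow (by norm_num)

theorem distSq_eq (hμ : MemLp (fun x : RR d => x) 2 μ) (X Y : CharMap μ) :
    distSq X Y = (∫ p, ‖X.map p.1 p.2 - Y.map p.1 p.2‖ ^ 2 ∂(timeProd μ))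
      + ∫ x, ‖X.map x 1 - Y.map x 1‖ ^ 2 ∂μ := by
  rw [distSq, integral_prod_symm _ (integrable_dist_sq hμ X Y),
    intervalIntegral.integral_of_le zero_le_one, ← integral_Icc_eq_integral_Ioc]

end Integrals

/-! ### Strong convexity and the proximal contraction -/

section Convexity

variable {d : ℕ} {μ : Measure (RR d)} [IsProbabilityMeasure μ]

/-- The characteristic map `(1 - s) X + s Y`. -/
def CharMap.lerp (X Y : CharMap μ) (s : ℝ) : CharMap μ where
  map x t := (1 - s) • X.map x t + s • Y.map x t
  vel x t := (1 - s) • X.vel x t + s • Y.vel x t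
  memLp_vel := (X.memLp_vel.const_smul (1 - s)).add (Y.memLp_vel.const_smul s)
  map_eq := by
    filter_upwards [X.map_eq, Y.map_eq, X.ae_intervalIntegrable_vel, Y.ae_intervalIntegrable_vel]
      with x hX hY iX iY t ht
    have h0 : (0 : ℝ) ∈ Icc (0 : ℝ) 1 := ⟨le_rfl, zero_le_one⟩
    rw [hX t ht, hY t ht, intervalIntegral.integral_add (f := fun r => (1 - s) • X.vel x r)
      (g := fun r => s • Y.vel x r) ((iX 0 h0 t ht).smul (1 - s))
      ((iY 0 h0 t ht).smul s), intervalIntegral.integral_smul, intervalIntegral.integral_smul]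
    module

theorem norm_lerp_sq {E : Type*} [NormedAddCommGroup E] [InnerProductSpace ℝ E] (a b : E) (s : ℝ) :
    ‖(1 - s) • a + s • b‖ ^ 2
      = (1 - s) * ‖a‖ ^ 2 + s * ‖b‖ ^ 2 - s * (1 - s) * ‖a - b‖ ^ 2 := by
  rw [norm_add_sq_real, norm_sub_sq_real, norm_smul, norm_smul, mul_pow, mul_pow,
    Real.norm_eq_abs, Real.norm_eq_abs, sq_abs, sq_abs, inner_smul_left, inner_smul_right]
  simp
  ring

theorem integral_lerp_sub {Ω : Type*} [MeasurableSpace Ω] {P : Measure Ω} {f g h : Ω → ℝ}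
    (hf : Integrable f P) (hg : Integrable g P) (hh : Integrable h P) (a b c : ℝ) :
    ∫ ω, (a * f ω + b * g ω - c * h ω) ∂P
      = a * (∫ ω, f ω ∂P) + b * (∫ ω, g ω ∂P) - c * ∫ ω, h ω ∂P := by
  rw [integral_sub (f := fun ω => a * f ω + b * g ω) ((hf.const_mul a).add (hg.const_mul b))
    (hh.const_mul c), integral_add (hf.const_mul a) (hg.const_mul b)]
  simp only [integral_const_mul]

theorem distSq_lerp (hμ : MemLp (fun x : RR d => x) 2 μ) (A B X : CharMap μ) (s : ℝ) :
    distSq (A.lerp B s) X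
      = (1 - s) * distSq A X + s * distSq B X - s * (1 - s) * distSq A B := by
  have key : ∀ a b x : RR d, ‖(1 - s) • a + s • b - x‖ ^ 2
      = (1 - s) * ‖a - x‖ ^ 2 + s * ‖b - x‖ ^ 2 - s * (1 - s) * ‖a - b‖ ^ 2 := by
    intro a b x
    have h := norm_lerp_sq (a - x) (b - x) s
    rw [sub_sub_sub_cancel_right] at h
    rw [← h]
    congr 2
    module
  rw [distSq_eq hμ, distSq_eq hμ, distSq_eq hμ, distSq_eq hμ]
  simp only [CharMap.lerp, key]
  rw [integral_lerp_sub (integrable_dist_sq hμ A X) (integrable_dist_sq hμ B X)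
    (integrable_dist_sq hμ A B), integral_lerp_sub (integrable_dist_sq_one hμ A X)
    (integrable_dist_sq_one hμ B X) (integrable_dist_sq_one hμ A B)]
  ring

/-- Strong convexity of `F` and `G` makes the cost strongly convex with respect to `distSq`; the
kinetic term is convex. -/
theorem cost_lerp_le (hμ : MemLp (fun x : RR d => x) 2 μ) {F G : RR d → ℝ} {L : NNReal}
    (hF : IsLSmooth L F) (hG : IsLSmooth L G) {lam : ℝ} (hFc : StrongConvexOn Set.univ lam F)
    (hGc : StrongConvexOn Set.univ lam G) (A B : CharMap μ) {s : ℝ} (hs : s ∈ Icc (0 : ℝ) 1) :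
    cost F G (A.lerp B s)
      ≤ (1 - s) * cost F G A + s * cost F G B - s * (1 - s) * (lam / 2 * distSq A B) := by
  have hs1 : 0 ≤ 1 - s := sub_nonneg.2 hs.2
  have hc : ∀ f : RR d → ℝ, StrongConvexOn Set.univ lam f → ∀ a b : RR d,
      f ((1 - s) • a + s • b)
        ≤ (1 - s) * f a + s * f b - s * (1 - s) * (lam / 2) * ‖a - b‖ ^ 2 := by
    intro f hf a b
    have := hf.2 (mem_univ a) (mem_univ b) hs1 hs.1 (by ring)
    simp only [smul_eq_mul] at this
    refine this.trans (le_of_eq ?_)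
    ring
  have hv : ∀ Z : CharMap μ,
      Integrable (fun p : RR d × ℝ => ‖Z.vel p.1 p.2‖ ^ 2) (timeProd μ) :=
    fun Z => Z.memLp_vel.integrable_norm_pow (by norm_num)
  have hf : ∀ Z : CharMap μ, Integrable (fun p : RR d × ℝ => F (Z.map p.1 p.2)) (timeProd μ) :=
    fun Z => hF.integrable_comp (Z.memLp_map hμ)
  have hg : ∀ Z : CharMap μ, Integrable (fun x => G (Z.map x 1)) μ :=
    fun Z => hG.integrable_comp (Z.memLp_map_time hμ ⟨zero_le_one, le_rfl⟩)
  have i0 : Integrable (fun _ : RR d × ℝ => (0 : ℝ)) (timeProd μ) := integrable_zero _ _ _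
  have iD := integrable_dist_sq hμ A B
  have iD1 := integrable_dist_sq_one hμ A B
  have h1 : ∫ p, ‖(A.lerp B s).vel p.1 p.2‖ ^ 2 ∂(timeProd μ)
      ≤ ∫ p, ((1 - s) * ‖A.vel p.1 p.2‖ ^ 2 + s * ‖B.vel p.1 p.2‖ ^ 2 - 0 * 0) ∂(timeProd μ) := by
    refine integral_mono (hv _)
      ((((hv A).const_mul _).add ((hv B).const_mul _)).sub (i0.const_mul 0)) fun p => ?_
    have h : 0 ≤ s * (1 - s) * ‖A.vel p.1 p.2 - B.vel p.1 p.2‖ ^ 2 :=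
      mul_nonneg (mul_nonneg hs.1 hs1) (sq_nonneg _)
    simp only [CharMap.lerp, norm_lerp_sq]
    linarith
  have h2 : ∫ p, F ((A.lerp B s).map p.1 p.2) ∂(timeProd μ)
      ≤ ∫ p, ((1 - s) * F (A.map p.1 p.2) + s * F (B.map p.1 p.2)
        - s * (1 - s) * (lam / 2) * ‖A.map p.1 p.2 - B.map p.1 p.2‖ ^ 2) ∂(timeProd μ) :=
    integral_mono (hf _) ((((hf A).const_mul _).add ((hf B).const_mul _)).sub (iD.const_mul _))
      fun p => hc F hFc _ _
  have h3 : ∫ x, G ((A.lerp B s).map x 1) ∂μ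
      ≤ ∫ x, ((1 - s) * G (A.map x 1) + s * G (B.map x 1)
        - s * (1 - s) * (lam / 2) * ‖A.map x 1 - B.map x 1‖ ^ 2) ∂μ :=
    integral_mono (hg _) ((((hg A).const_mul _).add ((hg B).const_mul _)).sub (iD1.const_mul _))
      fun p => hc G hGc _ _
  rw [integral_lerp_sub (hv A) (hv B) i0] at h1
  rw [integral_lerp_sub (hf A) (hf B) iD] at h2
  rw [integral_lerp_sub (hg A) (hg B) iD1] at h3
  rw [cost_eq hμ hF hG, cost_eq hμ hF hG, cost_eq hμ hF hG, distSq_eq hμ]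
  linarith

/-- First-order optimality in the form that strong convexity allows: the inequality along the
segment from a minimizer, divided by `s`, passes to the limit `s → 0`. -/
theorem add_le_of_forall_lerp {a b c : ℝ}
    (h : ∀ s ∈ Icc (0 : ℝ) 1, a ≤ (1 - s) * a + s * b - s * (1 - s) * c) : a + c ≤ b := by
  have h1 : ∀ s ∈ Ioo (0 : ℝ) 1, a + (1 - s) * c ≤ b := by
    intro s hs
    have := h s (Ioo_subset_Icc_self hs)
    have h2 : 0 ≤ s * (b - a - (1 - s) * c) := by linarith
    have := nonneg_of_mul_nonneg_right h2 hs.1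
    linarith
  by_contra! hb
  rcases le_or_gt c 0 with hc | hc
  · have := h1 (1 / 2) ⟨by norm_num, by norm_num⟩
    linarith
  · have hba : a ≤ b := by
      have := h 1 ⟨zero_le_one, le_rfl⟩
      linarith
    -- at `s = δ / (2 * c)` the margin `(1 - s) * c = c - δ / 2` still exceeds `b - a = c - δ`
    set δ := a + c - b
    have hδ : 0 < δ := by simp only [δ]; linarith
    have hδc : δ ≤ c := by simp only [δ]; linarith
    have hq : δ / (2 * c) * c = δ / 2 := by field_simp
    have := h1 (δ / (2 * c)) ⟨by positivity, by rw [div_lt_one (by positivity)]; linarith⟩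
    simp only [sub_mul, one_mul, hq] at this
    simp only [δ] at this hδ
    linarith

theorem IsParticleUpdate.contraction (hμ : MemLp (fun x : RR d => x) 2 μ) {F G : RR d → ℝ}
    {L : NNReal} (hF : IsLSmooth L F) (hG : IsLSmooth L G) {α : ℝ} (hα : 0 < α) {lam : ℝ}
    (hFc : StrongConvexOn Set.univ lam F) (hGc : StrongConvexOn Set.univ lam G)
    {Xs : CharMap μ} (hXs : ∀ Z : CharMap μ, cost F G Xs ≤ cost F G Z) {X X' : CharMap μ}
    (h : IsParticleUpdate F G α X X') :
    (1 + 2 * lam * α) * distSq X' Xs ≤ distSq X Xs := by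
  have h1 : cost F G Xs + lam / 2 * distSq Xs X' ≤ cost F G X' :=
    add_le_of_forall_lerp fun s hs =>
      (hXs _).trans (cost_lerp_le hμ hF hG hFc hGc Xs X' hs)
  have h2 : (cost F G X' + 1 / (2 * α) * distSq X' X)
      + (lam / 2 * distSq X' Xs + 1 / (2 * α) * distSq X' Xs)
      ≤ cost F G Xs + 1 / (2 * α) * distSq Xs X :=
    add_le_of_forall_lerp fun s hs => by
      have a1 := h (X'.lerp Xs s)
      have a2 := cost_lerp_le hμ hF hG hFc hGc X' Xs hs
      rw [distSq_lerp hμ] at a1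
      linarith
  rw [distSq_comm Xs X'] at h1
  rw [distSq_comm Xs X] at h2
  have h3 : 0 ≤ 1 / (2 * α) * distSq X' X := mul_nonneg (by positivity) (distSq_nonneg _ _)
  have h4 : lam * distSq X' Xs + 1 / (2 * α) * distSq X' Xs ≤ 1 / (2 * α) * distSq X Xs := by
    linarith
  have h5 := mul_le_mul_of_nonneg_left h4 (by positivity : 0 ≤ 2 * α)
  have e : 2 * α * (1 / (2 * α)) = 1 := by field_simp
  calc (1 + 2 * lam * α) * distSq X' Xs
      = 2 * α * (lam * distSq X' Xs) + 2 * α * (1 / (2 * α)) * distSq X' Xs := by rw [e]; ring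
    _ ≤ 2 * α * (1 / (2 * α)) * distSq X Xs := by linarith
    _ = distSq X Xs := by rw [e, one_mul]

theorem IsParticleUpdate.distSq_le_geometric (hμ : MemLp (fun x : RR d => x) 2 μ)
    {F G : RR d → ℝ} {L : NNReal} (hF : IsLSmooth L F) (hG : IsLSmooth L G) {α : ℝ} (hα : 0 < α)
    {lam : ℝ} (hlam : 0 < lam) (hFc : StrongConvexOn Set.univ lam F)
    (hGc : StrongConvexOn Set.univ lam G)
    {Xs : CharMap μ} (hXs : ∀ Z : CharMap μ, cost F G Xs ≤ cost F G Z) {X : ℕ → CharMap μ}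
    (h : ∀ l, IsParticleUpdate F G α (X l) (X (l + 1))) (l : ℕ) :
    distSq (X l) Xs ≤ 1 / (1 + 2 * lam * α) ^ l * distSq (X 0) Xs := by
  have hq : 0 < 1 + 2 * lam * α := by positivity
  induction l with
  | zero => simp
  | succ l ih =>
    have h1 := (h l).contraction hμ hF hG hα hFc hGc hXs
    have h2 : distSq (X (l + 1)) Xs ≤ 1 / (1 + 2 * lam * α) * distSq (X l) Xs := by
      rw [one_div, inv_mul_eq_div, le_div_iff₀ hq]; linarith
    refine h2.trans ((mul_le_mul_of_nonneg_left ih (by positivity)).trans (le_of_eq ?_))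
    rw [pow_succ]
    field_simp

end Convexity

/-! ### Test functions with Lipschitz gradient -/

section TestFunctions

variable {E G : Type*} [NormedAddCommGroup E] [NormedSpace ℝ E] [NormedAddCommGroup G]
  [NormedSpace ℝ G]

/-- `f` is differentiable, its derivative is bounded by `L`, and its derivative is `N`-Lipschitz.
The constants are part of the predicate because the errors of the Euler scheme are controlled by
them. -/
structure IsC11 (f : E → G) (L N : ℝ) : Prop where
  differentiable : Differentiable ℝ f
  nonneg : 0 ≤ N
  norm_fderiv_le : ∀ x, ‖fderiv ℝ f x‖ ≤ L
  norm_fderiv_sub_le : ∀ x y, ‖fderiv ℝ f x - fderiv ℝ f y‖ ≤ N * ‖x - y‖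

namespace IsC11

variable {f : E → G} {L N : ℝ}

theorem nonneg_left (h : IsC11 f L N) : 0 ≤ L := (norm_nonneg _).trans (h.norm_fderiv_le 0)

theorem mono (h : IsC11 f L N) {L' N' : ℝ} (hL : L ≤ L') (hN : N ≤ N') : IsC11 f L' N' where
  differentiable := h.differentiable
  nonneg := h.nonneg.trans hN
  norm_fderiv_le x := (h.norm_fderiv_le x).trans hL
  norm_fderiv_sub_le x y := (h.norm_fderiv_sub_le x y).trans (by gcongr)

theorem norm_sub_le (h : IsC11 f L N) (x y : E) : ‖f y - f x‖ ≤ L * ‖y - x‖ :=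
  (convex_univ).norm_image_sub_le_of_norm_fderiv_le (𝕜 := ℝ) (fun z _ => h.differentiable z)
    (fun z _ => h.norm_fderiv_le z) (mem_univ x) (mem_univ y)

theorem continuous_fderiv (h : IsC11 f L N) : Continuous (fderiv ℝ f) :=
  (LipschitzWith.of_dist_le_mul (K := N.toNNReal) fun x y => by
    rw [dist_eq_norm, dist_eq_norm, Real.coe_toNNReal _ h.nonneg]
    exact h.norm_fderiv_sub_le x y).continuous

theorem taylor (h : IsC11 f L N) (x y : E) :
    ‖f y - f x - fderiv ℝ f x (y - x)‖ ≤ N * ‖y - x‖ ^ 2 := by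
  have := (convex_closedBall x ‖y - x‖).norm_image_sub_le_of_norm_fderiv_le' (𝕜 := ℝ)
    (φ := fderiv ℝ f x) (C := N * ‖y - x‖) (fun z _ => h.differentiable z)
    (fun z hz => (h.norm_fderiv_sub_le z x).trans
      (mul_le_mul_of_nonneg_left (by simpa [dist_eq_norm] using hz) h.nonneg))
    (Metric.mem_closedBall_self (norm_nonneg _)) (y := y) (by simp [dist_eq_norm])
  refine this.trans (le_of_eq ?_)
  ring

/-- The second-order constant `n` of the displacement enters linearly, so that its contributions add
up to a bounded amount over the steps of the Euler scheme. -/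
theorem comp_id_add (h : IsC11 f L N) {s : E → E} {l n : ℝ} (hs : IsC11 s l n) :
    IsC11 (fun x => f (x + s x)) (L * (1 + l)) (N * (1 + l) ^ 2 + L * n) := by
  have hS : ∀ x, HasFDerivAt (fun x => x + s x) (ContinuousLinearMap.id ℝ E + fderiv ℝ s x) x :=
    fun x => (hasFDerivAt_id x).add (hs.differentiable x).hasFDerivAt
  have hd : ∀ x, HasFDerivAt (fun x => f (x + s x))
      ((fderiv ℝ f (x + s x)).comp (ContinuousLinearMap.id ℝ E + fderiv ℝ s x)) x :=
    fun x => (h.differentiable _).hasFDerivAt.comp x (hS x)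
  have hl := hs.nonneg_left
  have hL := h.nonneg_left
  have hN := h.nonneg
  have hn := hs.nonneg
  have hA : ∀ x, ‖ContinuousLinearMap.id ℝ E + fderiv ℝ s x‖ ≤ 1 + l := fun x =>
    (norm_add_le _ _).trans (add_le_add ContinuousLinearMap.norm_id_le (hs.norm_fderiv_le x))
  have hSl : ∀ x y, ‖(x + s x) - (y + s y)‖ ≤ (1 + l) * ‖x - y‖ := fun x y => by
    have h1 := hs.norm_sub_le y x
    calc ‖(x + s x) - (y + s y)‖ = ‖(x - y) + (s x - s y)‖ := by congr 1; abel
      _ ≤ ‖x - y‖ + ‖s x - s y‖ := norm_add_le _ _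
      _ ≤ _ := by linarith
  refine ⟨fun x => (hd x).differentiableAt, by positivity, fun x => ?_, fun x y => ?_⟩
  · rw [(hd x).fderiv]
    exact (ContinuousLinearMap.opNorm_comp_le _ _).trans
      (mul_le_mul (h.norm_fderiv_le _) (hA x) (norm_nonneg _) hL)
  · rw [(hd x).fderiv, (hd y).fderiv]
    have e : (fderiv ℝ f (x + s x)).comp (ContinuousLinearMap.id ℝ E + fderiv ℝ s x)
        - (fderiv ℝ f (y + s y)).comp (ContinuousLinearMap.id ℝ E + fderiv ℝ s y)
        = (fderiv ℝ f (x + s x) - fderiv ℝ f (y + s y)).comp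
            (ContinuousLinearMap.id ℝ E + fderiv ℝ s x)
          + (fderiv ℝ f (y + s y)).comp (fderiv ℝ s x - fderiv ℝ s y) := by
      ext z
      simp only [sub_apply, add_apply,
        ContinuousLinearMap.comp_apply, map_add, map_sub]
      abel
    rw [e]
    have h1 := h.norm_fderiv_sub_le (x + s x) (y + s y)
    have h2 : ‖fderiv ℝ f (x + s x) - fderiv ℝ f (y + s y)‖ ≤ N * ((1 + l) * ‖x - y‖) :=
      h1.trans (mul_le_mul_of_nonneg_left (hSl x y) hN)
    calc _ ≤ ‖fderiv ℝ f (x + s x) - fderiv ℝ f (y + s y)‖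
            * ‖ContinuousLinearMap.id ℝ E + fderiv ℝ s x‖
          + ‖fderiv ℝ f (y + s y)‖ * ‖fderiv ℝ s x - fderiv ℝ s y‖ :=
          (norm_add_le _ _).trans (add_le_add (ContinuousLinearMap.opNorm_comp_le _ _)
            (ContinuousLinearMap.opNorm_comp_le _ _))
      _ ≤ N * ((1 + l) * ‖x - y‖) * (1 + l) + L * (n * ‖x - y‖) := by
          gcongr
          · exact hA x
          · exact h.norm_fderiv_le _
          · exact hs.norm_fderiv_sub_le x y
      _ = _ := by ring

theorem fderiv_mul' {χ u : E → ℝ} {c Nχ L N : ℝ} (hχ : IsC11 χ c Nχ) (hu : IsC11 u L N) (x : E) :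
    fderiv ℝ (fun x => χ x * u x) x = χ x • fderiv ℝ u x + u x • fderiv ℝ χ x :=
  fderiv_fun_mul (hχ.differentiable x) (hu.differentiable x)

theorem norm_smul_fderiv_sub_le {χ u : E → ℝ} {c Nχ L N U : ℝ} (hχ : IsC11 χ c Nχ)
    (hu : IsC11 u L N) (h1 : ∀ x, |χ x| ≤ U) (x y : E) :
    ‖χ x • fderiv ℝ u x - χ y • fderiv ℝ u y‖ ≤ (U * N + c * L) * ‖x - y‖ := by
  have e : χ x • fderiv ℝ u x - χ y • fderiv ℝ u y
      = χ x • (fderiv ℝ u x - fderiv ℝ u y) + (χ x - χ y) • fderiv ℝ u y := by module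
  have hU : 0 ≤ U := (abs_nonneg _).trans (h1 0)
  have hN := hu.nonneg
  have hc := hχ.nonneg_left
  rw [e]
  calc _ ≤ |χ x| * ‖fderiv ℝ u x - fderiv ℝ u y‖ + ‖χ x - χ y‖ * ‖fderiv ℝ u y‖ := by
        refine (norm_add_le _ _).trans (le_of_eq ?_)
        rw [norm_smul, norm_smul, Real.norm_eq_abs (χ x)]
    _ ≤ U * (N * ‖x - y‖) + c * ‖x - y‖ * L := by
        gcongr
        · exact h1 x
        · exact hu.norm_fderiv_sub_le x y
        · exact hχ.norm_sub_le y x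
        · exact hu.norm_fderiv_le y
    _ = _ := by ring

theorem mul {χ u : E → ℝ} {c Nχ L N U V : ℝ} (hχ : IsC11 χ c Nχ) (hu : IsC11 u L N)
    (h1 : ∀ x, |χ x| ≤ V) (h2 : ∀ x, |u x| ≤ U) :
    IsC11 (fun x => χ x * u x) (V * L + U * c) ((V * N + c * L) + (U * Nχ + L * c)) := by
  have hU : 0 ≤ U := (abs_nonneg _).trans (h2 0)
  have hV : 0 ≤ V := (abs_nonneg _).trans (h1 0)
  have hN := hu.nonneg
  have hNχ := hχ.nonneg
  have hL := hu.nonneg_left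
  have hc := hχ.nonneg_left
  refine ⟨hχ.differentiable.mul hu.differentiable, by positivity, fun x => ?_, fun x y => ?_⟩
  · rw [fderiv_mul' hχ hu]
    refine (norm_add_le _ _).trans ?_
    rw [norm_smul, norm_smul]
    gcongr
    · exact h1 x
    · exact hu.norm_fderiv_le x
    · exact h2 x
    · exact hχ.norm_fderiv_le x
  · rw [fderiv_mul' hχ hu, fderiv_mul' hχ hu, add_sub_add_comm, add_mul]
    exact (norm_add_le _ _).trans (add_le_add (norm_smul_fderiv_sub_le hχ hu h1 x y)
      (norm_smul_fderiv_sub_le hu hχ h2 x y))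

end IsC11

end TestFunctions

/-! ### Mollification of bounded Lipschitz fields -/

section Mollification

open scoped Convolution

theorem norm_convolution_le {E F₁ F₂ F₃ : Type*} [NormedAddCommGroup E] [MeasurableSpace E]
    {ν : Measure E} [NormedAddCommGroup F₁] [NormedSpace ℝ F₁]
    [NormedAddCommGroup F₂] [NormedSpace ℝ F₂] [NormedAddCommGroup F₃] [NormedSpace ℝ F₃]
    (B : F₁ →L[ℝ] F₂ →L[ℝ] F₃) {k : E → F₁} (hk : Integrable k ν) {f : E → F₂} {M : ℝ}
    (hM : ∀ x, ‖f x‖ ≤ M) (x : E) : ‖(k ⋆[B, ν] f) x‖ ≤ ‖B‖ * (∫ z, ‖k z‖ ∂ν) * M := by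
  have : ‖B‖ * (∫ z, ‖k z‖ ∂ν) * M = ∫ z, ‖B‖ * ‖k z‖ * M ∂ν := by
    rw [integral_mul_const, integral_const_mul]
  rw [this, convolution_def]
  refine norm_integral_le_of_norm_le ((hk.norm.const_mul _).mul_const _) (ae_of_all _ fun z => ?_)
  exact (B.le_opNorm₂ _ _).trans (by gcongr; exact hM _)

set_option maxSynthPendingDepth 3 in
/-- Convolution with a compactly supported `C¹` kernel maps bounded functions to Lipschitz
functions. -/
theorem exists_norm_convolution_sub_le {E F₁ F₂ F₃ : Type*} [NormedAddCommGroup E]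
    [NormedSpace ℝ E] [FiniteDimensional ℝ E] [MeasurableSpace E] [BorelSpace E]
    (ν : Measure E) [ν.IsAddHaarMeasure] [NormedAddCommGroup F₁] [NormedSpace ℝ F₁]
    [NormedAddCommGroup F₂] [NormedSpace ℝ F₂] [NormedAddCommGroup F₃] [NormedSpace ℝ F₃]
    (B : F₁ →L[ℝ] F₂ →L[ℝ] F₃) {k : E → F₁} (hk : ContDiff ℝ 1 k) (hs : HasCompactSupport k) :
    ∃ C : ℝ, 0 ≤ C ∧ ∀ (f : E → F₂) (M : ℝ), Continuous f → (∀ x, ‖f x‖ ≤ M) →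
      ∀ x y, ‖(k ⋆[B, ν] f) x - (k ⋆[B, ν] f) y‖ ≤ C * M * ‖x - y‖ := by
  have hk' : Integrable (fderiv ℝ k) ν :=
    (hk.continuous_fderiv (by norm_num)).integrable_of_hasCompactSupport (hs.fderiv ℝ)
  refine ⟨‖B.precompL E‖ * ∫ z, ‖fderiv ℝ k z‖ ∂ν, by positivity, fun f M hf hM x y => ?_⟩
  have hd : ∀ x, HasFDerivAt (k ⋆[B, ν] f) ((fderiv ℝ k ⋆[B.precompL E, ν] f) x) x := fun x =>
    hs.hasFDerivAt_convolution_left B hk hf.locallyIntegrable x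
  refine (convex_univ).norm_image_sub_le_of_norm_fderiv_le (𝕜 := ℝ)
    (fun z _ => (hd z).differentiableAt) (fun z _ => ?_) (mem_univ y) (mem_univ x)
  rw [(hd z).fderiv]
  exact norm_convolution_le _ hk' hM z

variable {E : Type*} [NormedAddCommGroup E] [InnerProductSpace ℝ E] [FiniteDimensional ℝ E]
  [MeasurableSpace E] [BorelSpace E]

/-- A bounded Lipschitz field has smooth approximations with the same bound and the same Lipschitz
constant, and with a second-order bound that depends on the field only through its bound. -/
theorem exists_mollification {ε : ℝ} (hε : 0 < ε) :
    ∃ C : ℝ, 0 ≤ C ∧ ∀ (f : E → E) (M K : ℝ), 0 ≤ M → 0 ≤ K → (∀ x, ‖f x‖ ≤ M) →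
      (∀ x y, ‖f x - f y‖ ≤ K * ‖x - y‖) →
      ∃ s : E → E, IsC11 s K (C * M) ∧ (∀ x, ‖s x‖ ≤ M) ∧ ∀ x, ‖s x - f x‖ ≤ K * ε := by
  let φ : ContDiffBump (0 : E) := ⟨ε / 2, ε, by positivity, by linarith⟩
  let k : E → ℝ := φ.normed volume
  have hkc : ContDiff ℝ 2 k := φ.contDiff_normed
  have hks : HasCompactSupport k := φ.hasCompactSupport_normed
  have hk0 : ∀ x, 0 ≤ k x := fun x => φ.nonneg_normed x
  have hk1 : ∫ x, k x = 1 := φ.integral_normed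
  have hki : Integrable k := hkc.continuous.integrable_of_hasCompactSupport hks
  let B := ContinuousLinearMap.lsmul ℝ ℝ (E := E)
  have hk'c : ContDiff ℝ 1 (fderiv ℝ k) := hkc.fderiv_right (by norm_num)
  have hk's : HasCompactSupport (fderiv ℝ k) := hks.fderiv ℝ
  obtain ⟨C, hC, hCb⟩ := exists_norm_convolution_sub_le volume (B.precompL E) hk'c hk's
  refine ⟨C, hC, ?_⟩
  intro f M K hM hK hfM hfK
  have hfc : Continuous f := (LipschitzWith.of_dist_le_mul (K := K.toNNReal) fun x y => by
    rw [dist_eq_norm, dist_eq_norm, Real.coe_toNNReal _ hK]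
    exact hfK x y).continuous
  have hfl : LocallyIntegrable f := hfc.locallyIntegrable
  let s : E → E := k ⋆[B, volume] f
  have hd : ∀ x, HasFDerivAt s ((fderiv ℝ k ⋆[B.precompL E, volume] f) x) x := fun x =>
    hks.hasFDerivAt_convolution_left B (hkc.of_le (by norm_num)) hfl x
  have hfd : fderiv ℝ s = fderiv ℝ k ⋆[B.precompL E, volume] f := funext fun x => (hd x).fderiv
  have hex : ∀ x, Integrable (fun t => k t • f (x - t)) := fun x =>
    hks.convolutionExists_left B hkc.continuous hfl x
  have hsx : ∀ x, s x = ∫ t, k t • f (x - t) := fun x => rfl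
  have hlip : ∀ x y, ‖s x - s y‖ ≤ K * ‖x - y‖ := fun x y => by
    rw [hsx, hsx, ← integral_sub (hex x) (hex y)]
    have e : K * ‖x - y‖ = ∫ t, k t * (K * ‖x - y‖) := by rw [integral_mul_const, hk1, one_mul]
    rw [e]
    refine norm_integral_le_of_norm_le (hki.mul_const _) (ae_of_all _ fun t => ?_)
    rw [← smul_sub, norm_smul, Real.norm_of_nonneg (hk0 t)]
    refine mul_le_mul_of_nonneg_left ((hfK _ _).trans (le_of_eq ?_)) (hk0 t)
    congr 2
    abel
  refine ⟨s, ⟨fun x => (hd x).differentiableAt, by positivity, fun x => ?_, fun x y => ?_⟩,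
    fun x => ?_, fun x => ?_⟩
  · refine norm_fderiv_le_of_lip' ℝ hK (Filter.Eventually.of_forall fun y => hlip y x)
  · rw [hfd]
    exact hCb f M hfc hfM x y
  · rw [hsx]
    have e : M = ∫ t, k t * M := by rw [integral_mul_const, hk1, one_mul]
    rw [e]
    refine norm_integral_le_of_norm_le (hki.mul_const _) (ae_of_all _ fun t => ?_)
    rw [norm_smul, Real.norm_of_nonneg (hk0 t)]
    exact mul_le_mul_of_nonneg_left (hfM _) (hk0 t)
  · rw [← dist_eq_norm]
    refine φ.dist_normed_convolution_le hfc.aestronglyMeasurable fun y hy => ?_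
    rw [dist_eq_norm]
    refine (hfK _ _).trans (mul_le_mul_of_nonneg_left ?_ hK)
    rw [← dist_eq_norm]
    exact (Metric.mem_ball.1 hy).le

end Mollification

/-! ### Drifts of trajectories and the flow matching loss -/

section WeakDrift

variable {d : ℕ} {μ : Measure (RR d)}

theorem integrable_inner_of_memLp {Ω E : Type*} [MeasurableSpace Ω] {P : Measure Ω}
    [NormedAddCommGroup E] [InnerProductSpace ℝ E] {f g : Ω → E} (hf : MemLp f 2 P)
    (hg : MemLp g 2 P) : Integrable (fun ω => inner ℝ (f ω) (g ω)) P := by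
  refine ((hf.integrable_norm_pow (by norm_num)).add
    (hg.integrable_norm_pow (by norm_num))).mono' (hf.1.inner hg.1) (ae_of_all _ fun ω => ?_)
  have := abs_real_inner_le_norm (f ω) (g ω)
  have h2 := two_mul_le_add_sq ‖f ω‖ ‖g ω‖
  have h3 := mul_nonneg (norm_nonneg (f ω)) (norm_nonneg (g ω))
  simp only [Real.norm_eq_abs, Pi.add_apply]
  linarith

/-- The random trajectory `Z` has Markovian drift `v`: the field `v` along `Z` is square integrable,
and it is the orthogonal projection of `∂ₜZ` in `L²(μ ⊗ [0,1])` onto the functions of `(Z(x,t), t)`.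
In particular, the laws of `Z(·,t)` solve the continuity equation with velocity `v`. -/
structure IsWeakDrift (Z : CharMap μ) (v : RR d → ℝ → RR d) : Prop where
  measurable : Measurable (Function.uncurry v)
  memLp : MemLp (fun p : RR d × ℝ => v (Z.map p.1 p.2) p.2) 2 (timeProd μ)
  integral_inner_eq_zero : ∀ η : RR d → ℝ → RR d, Measurable (Function.uncurry η) →
    MemLp (fun p : RR d × ℝ => η (Z.map p.1 p.2) p.2) 2 (timeProd μ) →
    ∫ p, inner ℝ (η (Z.map p.1 p.2) p.2) (Z.vel p.1 p.2 - v (Z.map p.1 p.2) p.2)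
      ∂(timeProd μ) = 0

theorem CharMap.aestronglyMeasurable_comp (Z : CharMap μ) {E : Type*} [TopologicalSpace E]
    [TopologicalSpace.PseudoMetrizableSpace E] [SecondCountableTopology E] [MeasurableSpace E]
    [OpensMeasurableSpace E] {v : RR d → ℝ → E}
    (hv : Measurable (Function.uncurry v)) :
    AEStronglyMeasurable (fun p : RR d × ℝ => v (Z.map p.1 p.2) p.2) (timeProd μ) :=
  (hv.comp_aemeasurable
    (Z.aestronglyMeasurable_map.aemeasurable.prodMk
      measurable_snd.aemeasurable)).aestronglyMeasurable

/-- The drift carries at most the kinetic energy of the trajectory, as an orthogonal projection. -/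
theorem IsWeakDrift.integral_norm_sq_le {Z : CharMap μ} {v : RR d → ℝ → RR d}
    (h : IsWeakDrift Z v) :
    ∫ p, ‖v (Z.map p.1 p.2) p.2‖ ^ 2 ∂(timeProd μ) ≤ ∫ p, ‖Z.vel p.1 p.2‖ ^ 2 ∂(timeProd μ) := by
  have h0 := h.integral_inner_eq_zero v h.measurable h.memLp
  have i1 : Integrable (fun p : RR d × ℝ => ‖v (Z.map p.1 p.2) p.2‖ ^ 2) (timeProd μ) :=
    h.memLp.integrable_norm_pow (by norm_num)
  have i2 : Integrable (fun p : RR d × ℝ => ‖Z.vel p.1 p.2‖ ^ 2) (timeProd μ) :=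
    Z.memLp_vel.integrable_norm_pow (by norm_num)
  have i3 : Integrable (fun p : RR d × ℝ => inner ℝ (v (Z.map p.1 p.2) p.2)
      (Z.vel p.1 p.2 - v (Z.map p.1 p.2) p.2)) (timeProd μ) :=
    integrable_inner_of_memLp h.memLp (Z.memLp_vel.sub h.memLp)
  have h1 : ∫ p, (‖v (Z.map p.1 p.2) p.2‖ ^ 2 + 2 * inner ℝ (v (Z.map p.1 p.2) p.2)
      (Z.vel p.1 p.2 - v (Z.map p.1 p.2) p.2)) ∂(timeProd μ)
      ≤ ∫ p, ‖Z.vel p.1 p.2‖ ^ 2 ∂(timeProd μ) := by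
    refine integral_mono (i1.add (i3.const_mul 2)) i2 fun p => ?_
    have := norm_add_sq_real (v (Z.map p.1 p.2) p.2) (Z.vel p.1 p.2 - v (Z.map p.1 p.2) p.2)
    rw [add_sub_cancel] at this
    simp only [this]
    linarith [sq_nonneg ‖Z.vel p.1 p.2 - v (Z.map p.1 p.2) p.2‖]
  rw [integral_add i1 (i3.const_mul 2), integral_const_mul, h0] at h1
  linarith

theorem SolvesODE.ae_eq {Z : CharMap μ} {v : RR d → ℝ → RR d} (h : SolvesODE Z v)
    (hv : Measurable (Function.uncurry v)) :
    ∀ᵐ p ∂(timeProd μ), Z.vel p.1 p.2 = v (Z.map p.1 p.2) p.2 := by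
  have hm := (Z.memLp_vel.1.sub (Z.aestronglyMeasurable_comp hv)).enorm
  have h0 : (fun p => ‖(Function.uncurry Z.vel - fun p : RR d × ℝ => v (Z.map p.1 p.2) p.2) p‖ₑ)
      =ᵐ[timeProd μ] 0 := by
    rw [← lintegral_eq_zero_iff' hm, lintegral_prod _ hm,
      lintegral_congr_ae (g := fun _ => 0), lintegral_zero]
    filter_upwards [h] with x hx
    rw [lintegral_congr_ae (g := fun _ => 0), lintegral_zero]
    filter_upwards [hx] with t ht
    simp [ht]
  filter_upwards [h0] with p hp
  simpa [sub_eq_zero, Function.uncurry] using hp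

theorem SolvesODE.isWeakDrift {Z : CharMap μ} {v : RR d → ℝ → RR d} (h : SolvesODE Z v)
    (hv : Measurable (Function.uncurry v)) : IsWeakDrift Z v where
  measurable := hv
  memLp := Z.memLp_vel.ae_eq (h.ae_eq hv)
  integral_inner_eq_zero η _ _ := by
    rw [integral_congr_ae (g := fun _ => 0), integral_zero]
    filter_upwards [h.ae_eq hv] with p hp
    rw [hp, sub_self, inner_zero_right]

variable [IsProbabilityMeasure μ]

theorem matchingLoss_eq (Z : CharMap μ) {v : RR d → ℝ → RR d}
    (hv : Measurable (Function.uncurry v)) :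
    matchingLoss Z v
      = ∫⁻ p, ENNReal.ofReal (‖v (Z.map p.1 p.2) p.2 - Z.vel p.1 p.2‖ ^ 2) ∂(timeProd μ) := by
  have hm := (Z.aestronglyMeasurable_comp hv).sub Z.memLp_vel.1
  have hm' : AEMeasurable (fun p : RR d × ℝ =>
      ENNReal.ofReal (‖v (Z.map p.1 p.2) p.2 - Z.vel p.1 p.2‖ ^ 2)) (timeProd μ) :=
    (hm.norm.aemeasurable.pow_const 2).ennreal_ofReal
  rw [lintegral_prod_symm _ hm']
  simp only [matchingLoss, ENNReal.ofReal_pow (norm_nonneg _), ofReal_norm]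

/-- The first variation of the flow matching loss at a minimizer. -/
theorem IsFlowMatching.isWeakDrift {Z : CharMap μ} {v : RR d → ℝ → RR d}
    (h : IsFlowMatching Z v) : IsWeakDrift Z v := by
  have hm := (Z.aestronglyMeasurable_comp h.1).sub Z.memLp_vel.1
  have hD : MemLp (fun p : RR d × ℝ => v (Z.map p.1 p.2) p.2 - Z.vel p.1 p.2) 2
      (timeProd μ) := by
    refine (memLp_two_iff_integrable_sq_norm hm).2 ⟨hm.norm.pow 2, ?_⟩
    rw [hasFiniteIntegral_iff_ofReal (ae_of_all _ fun _ => sq_nonneg _)]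
    have h0 := h.2 (fun _ _ => 0) measurable_const
    rw [matchingLoss_eq Z h.1, matchingLoss_eq Z measurable_const] at h0
    refine h0.trans_lt ?_
    simp only [zero_sub, norm_neg]
    have := Z.memLp_vel.integrable_norm_pow (p := 2) (by norm_num)
    exact (hasFiniteIntegral_iff_ofReal (ae_of_all _ fun _ => sq_nonneg _)).1 this.2
  refine ⟨h.1, (hD.add Z.memLp_vel).ae_eq (ae_of_all _ fun p => by
    simp [Function.uncurry]), fun η hη hηL => ?_⟩
  set D := fun p : RR d × ℝ => v (Z.map p.1 p.2) p.2 - Z.vel p.1 p.2 with hDdef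
  set H := fun p : RR d × ℝ => η (Z.map p.1 p.2) p.2 with hHdef
  have iD : Integrable (fun p => ‖D p‖ ^ 2) (timeProd μ) := hD.integrable_norm_pow (by norm_num)
  have iH : Integrable (fun p => ‖H p‖ ^ 2) (timeProd μ) := hηL.integrable_norm_pow (by norm_num)
  have iI : Integrable (fun p => inner ℝ (H p) (D p)) (timeProd μ) :=
    integrable_inner_of_memLp hηL hD
  have key : ∀ s : ℝ, 0 ≤ 2 * s * (∫ p, inner ℝ (H p) (D p) ∂(timeProd μ))
      + s ^ 2 * ∫ p, ‖H p‖ ^ 2 ∂(timeProd μ) := by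
    intro s
    have hms : Measurable (Function.uncurry fun x t => v x t + s • η x t) :=
      h.1.add (hη.const_smul s)
    have h1 := h.2 _ hms
    have e : ∀ p : RR d × ℝ,
        ‖v (Z.map p.1 p.2) p.2 + s • η (Z.map p.1 p.2) p.2 - Z.vel p.1 p.2‖ ^ 2
          = ‖D p‖ ^ 2 + 2 * s * inner ℝ (H p) (D p) + s ^ 2 * ‖H p‖ ^ 2 := by
      intro p
      have : v (Z.map p.1 p.2) p.2 + s • η (Z.map p.1 p.2) p.2 - Z.vel p.1 p.2
          = D p + s • H p := by simp only [hDdef, hHdef]; abel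
      rw [this, norm_add_sq_real, inner_smul_right, norm_smul, mul_pow, Real.norm_eq_abs, sq_abs,
        real_inner_comm]
      ring
    have iall : Integrable (fun p => ‖D p‖ ^ 2 + 2 * s * inner ℝ (H p) (D p) + s ^ 2 * ‖H p‖ ^ 2)
        (timeProd μ) := (iD.add (iI.const_mul _)).add (iH.const_mul _)
    have hnn : ∀ p, 0 ≤ ‖D p‖ ^ 2 + 2 * s * inner ℝ (H p) (D p) + s ^ 2 * ‖H p‖ ^ 2 :=
      fun p => (e p).symm ▸ sq_nonneg _
    rw [matchingLoss_eq Z h.1, matchingLoss_eq Z hms] at h1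
    simp only [e] at h1
    rw [← ofReal_integral_eq_lintegral_ofReal iD (ae_of_all _ fun _ => sq_nonneg _),
      ← ofReal_integral_eq_lintegral_ofReal iall (ae_of_all _ hnn)] at h1
    have h2 : (∫ p, ‖D p‖ ^ 2 ∂(timeProd μ)) ≤ _ := (ENNReal.ofReal_le_ofReal_iff
      (integral_nonneg hnn)).1 h1
    rw [integral_add (f := fun p => ‖D p‖ ^ 2 + 2 * s * inner ℝ (H p) (D p))
      (iD.add (iI.const_mul _)) (iH.const_mul _), integral_add iD (iI.const_mul _),
      integral_const_mul, integral_const_mul] at h2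
    linarith
  have hzero : ∫ p, inner ℝ (H p) (D p) ∂(timeProd μ) = 0 := by
    set A := ∫ p, inner ℝ (H p) (D p) ∂(timeProd μ)
    set B := ∫ p, ‖H p‖ ^ 2 ∂(timeProd μ)
    have hB : 0 ≤ B := integral_nonneg fun _ => sq_nonneg _
    -- the shift `B + 1` avoids the division by `B = 0`
    have h1 := key (-A / (B + 1))
    have e : 2 * (-A / (B + 1)) * A + (-A / (B + 1)) ^ 2 * B
        = -(A ^ 2 * (B + 2) / (B + 1) ^ 2) := by field_simp; ring
    rw [e] at h1
    have h3 : 0 ≤ A ^ 2 * (B + 2) / (B + 1) ^ 2 := by positivity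
    have h4 : A ^ 2 * (B + 2) / (B + 1) ^ 2 = 0 := by linarith
    have h5 : (B + 2) / (B + 1) ^ 2 ≠ 0 := by positivity
    rw [mul_div_assoc, mul_eq_zero] at h4
    simpa using h4.resolve_right h5
  have : ∀ p : RR d × ℝ, inner ℝ (η (Z.map p.1 p.2) p.2) (Z.vel p.1 p.2 - v (Z.map p.1 p.2) p.2)
      = -inner ℝ (H p) (D p) := fun p => by
    rw [← inner_neg_right]; simp only [hDdef, hHdef, neg_sub]
  simp only [this]
  rw [integral_neg, hzero, neg_zero]

end WeakDrift

/-! ### Expansions along a path -/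

section PathEstimate

variable {E : Type*} [NormedAddCommGroup E] [NormedSpace ℝ E]

theorem integrable_clm_apply {Ω : Type*} [MeasurableSpace Ω] {P : Measure Ω}
    {A : Ω → E →L[ℝ] ℝ} {f : Ω → E} {L : ℝ} (hA : AEStronglyMeasurable A P)
    (hL : ∀ ω, ‖A ω‖ ≤ L) (hf : Integrable f P) : Integrable (fun ω => A ω (f ω)) P := by
  refine (hf.norm.const_mul L).mono'
    ((ContinuousLinearMap.id ℝ (E →L[ℝ] ℝ)).aestronglyMeasurable_comp₂ hA hf.1)
    (ae_of_all _ fun ω => ?_)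
  exact (ContinuousLinearMap.le_opNorm _ _).trans (by gcongr; exact hL _)

variable [CompleteSpace E]

/-- The chain rule along an absolutely continuous path, with a second-order error: no
differentiation of `φ ∘ z` is needed, because the Euler scheme tolerates errors of this size. -/
theorem IsC11.path_expansion {φ : E → ℝ} {Lφ Nφ : ℝ} (hφ : IsC11 φ Lφ Nφ) {z z' : ℝ → E}
    {a b : ℝ} (hab : a ≤ b) (hi : IntegrableOn z' (Ioc a b))
    (hzm : AEStronglyMeasurable z (volume.restrict (Ioc a b)))
    (hz : ∀ t ∈ Icc a b, z t - z a = ∫ r in Ioc a t, z' r) :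
    |φ (z b) - φ (z a) - ∫ t in Ioc a b, fderiv ℝ φ (z t) (z' t)|
      ≤ 2 * Nφ * (∫ t in Ioc a b, ‖z' t‖) ^ 2 := by
  set l := ∫ t in Ioc a b, ‖z' t‖ with hl
  have hN := hφ.nonneg
  have hl0 : 0 ≤ l := integral_nonneg fun _ => norm_nonneg _
  have hza : ∀ t ∈ Icc a b, ‖z t - z a‖ ≤ l := fun t ht => by
    rw [hz t ht]
    refine (norm_integral_le_integral_norm _).trans ?_
    exact setIntegral_mono_set hi.norm (ae_of_all _ fun _ => norm_nonneg _)
      (Ioc_subset_Ioc_right ht.2).eventuallyLE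
  have h1 := hφ.taylor (z a) (z b)
  have hb := hza b ⟨hab, le_rfl⟩
  have i1 : IntegrableOn (fun t => fderiv ℝ φ (z a) (z' t)) (Ioc a b) :=
    (fderiv ℝ φ (z a)).integrable_comp hi
  have i2 : IntegrableOn (fun t => fderiv ℝ φ (z t) (z' t)) (Ioc a b) :=
    integrable_clm_apply (hφ.continuous_fderiv.comp_aestronglyMeasurable hzm)
      (fun _ => hφ.norm_fderiv_le _) hi
  have e : fderiv ℝ φ (z a) (z b - z a) = ∫ t in Ioc a b, fderiv ℝ φ (z a) (z' t) := by
    rw [hz b ⟨hab, le_rfl⟩, ContinuousLinearMap.integral_comp_comm _ hi]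
  have h2 : ‖(∫ t in Ioc a b, fderiv ℝ φ (z a) (z' t)) - ∫ t in Ioc a b, fderiv ℝ φ (z t) (z' t)‖
      ≤ Nφ * l * l := by
    rw [← integral_sub i1 i2]
    nth_rewrite 2 [hl]
    rw [← integral_const_mul]
    refine norm_integral_le_of_norm_le (hi.norm.const_mul _) ?_
    filter_upwards [ae_restrict_mem measurableSet_Ioc] with t ht
    rw [← sub_apply]
    refine (ContinuousLinearMap.le_opNorm _ _).trans (mul_le_mul_of_nonneg_right ?_ (norm_nonneg _))
    refine (hφ.norm_fderiv_sub_le _ _).trans (mul_le_mul_of_nonneg_left ?_ hN)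
    rw [norm_sub_rev]
    exact hza t (Ioc_subset_Icc_self ht)
  rw [e] at h1
  rw [Real.norm_eq_abs] at h1 h2
  have h3 : Nφ * ‖z b - z a‖ ^ 2 ≤ Nφ * l ^ 2 := by gcongr
  calc _ ≤ |φ (z b) - φ (z a) - ∫ t in Ioc a b, fderiv ℝ φ (z a) (z' t)|
        + |(∫ t in Ioc a b, fderiv ℝ φ (z a) (z' t))
          - ∫ t in Ioc a b, fderiv ℝ φ (z t) (z' t)| := by
        rw [← sub_add_sub_cancel]; exact abs_add_le _ _
    _ ≤ Nφ * l ^ 2 + Nφ * l * l := add_le_add (h1.trans h3) h2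
    _ = _ := by ring

/-- The change of a test function `u` under the displacement `s`, an approximation of the
displacement by the field `w` during `(a, b]`, is the time integral of `Du · w` along a path, up to
terms of higher order. -/
theorem IsC11.displacement_expansion {χ u : E → ℝ} {c Nχ L N : ℝ} (hχ : IsC11 χ c Nχ)
    (hu : IsC11 u L N) (hχ1 : ∀ x, |χ x| ≤ 1) {z z' : ℝ → E}
    {a b : ℝ} (hab : a ≤ b) (hi : IntegrableOn z' (Ioc a b))
    (hz : ∀ t ∈ Icc a b, z t - z a = ∫ r in Ioc a t, z' r) {w : E → ℝ → E} {M Λ δ : ℝ}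
    (hΛ : 0 ≤ Λ) (hwa : IntegrableOn (fun t => w (z a) t) (Ioc a b))
    (hwz : IntegrableOn (fun t => χ (z t) • fderiv ℝ u (z t) (w (z t) t)) (Ioc a b))
    (hwM : ∀ t ∈ Ioc a b, ∀ x, ‖w x t‖ ≤ M)
    (hwΛ : ∀ t ∈ Ioc a b, ∀ x y, ‖w x t - w y t‖ ≤ Λ * ‖x - y‖) {s : E}
    (hsM : ‖s‖ ≤ (b - a) * M) (hsδ : ‖s - ∫ t in Ioc a b, w (z a) t‖ ≤ (b - a) * δ) :
    |χ (z a) * (u (z a + s) - u (z a))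
        - ∫ t in Ioc a b, χ (z t) • fderiv ℝ u (z t) (w (z t) t)|
      ≤ N * ((b - a) * M) ^ 2 + L * ((b - a) * δ)
        + (b - a) * ((1 * N + c * L) * M + L * Λ) * ∫ t in Ioc a b, ‖z' t‖ := by
  set l := ∫ t in Ioc a b, ‖z' t‖ with hl
  have hN := hu.nonneg
  have hL := hu.nonneg_left
  have hc := hχ.nonneg_left
  have hba : 0 ≤ b - a := sub_nonneg.2 hab
  have hl0 : 0 ≤ l := integral_nonneg fun _ => norm_nonneg _
  have hza : ∀ t ∈ Icc a b, ‖z t - z a‖ ≤ l := fun t ht => by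
    rw [hz t ht]
    refine (norm_integral_le_integral_norm _).trans ?_
    exact setIntegral_mono_set hi.norm (ae_of_all _ fun _ => norm_nonneg _)
      (Ioc_subset_Ioc_right ht.2).eventuallyLE
  set A := fun x => χ x • fderiv ℝ u x with hA
  have hAL : ∀ x, ‖A x‖ ≤ L := fun x => by
    rw [hA, norm_smul, Real.norm_eq_abs]
    exact (mul_le_mul (hχ1 x) (hu.norm_fderiv_le x) (norm_nonneg _) zero_le_one).trans_eq
      (one_mul L)
  have h1 : |χ (z a) * (u (z a + s) - u (z a)) - A (z a) s| ≤ N * ((b - a) * M) ^ 2 := by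
    have ht := hu.taylor (z a) (z a + s)
    rw [add_sub_cancel_left, Real.norm_eq_abs] at ht
    have e : χ (z a) * (u (z a + s) - u (z a)) - A (z a) s
        = χ (z a) * (u (z a + s) - u (z a) - fderiv ℝ u (z a) s) := by
      simp only [hA, smul_apply, smul_eq_mul]; ring
    rw [e, abs_mul]
    calc _ ≤ 1 * (N * ‖s‖ ^ 2) := mul_le_mul (hχ1 _) ht (abs_nonneg _) zero_le_one
      _ ≤ _ := by rw [one_mul]; gcongr
  have h2 : |A (z a) s - ∫ t in Ioc a b, A (z a) (w (z a) t)| ≤ L * ((b - a) * δ) := by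
    rw [ContinuousLinearMap.integral_comp_comm _ hwa, ← map_sub, ← Real.norm_eq_abs]
    exact ((A (z a)).le_opNorm _).trans (mul_le_mul (hAL _) hsδ (norm_nonneg _) hL)
  have h3 : |(∫ t in Ioc a b, A (z a) (w (z a) t)) - ∫ t in Ioc a b, A (z t) (w (z t) t)|
      ≤ (b - a) * ((1 * N + c * L) * M + L * Λ) * l := by
    have hwz' : IntegrableOn (fun t => A (z t) (w (z t) t)) (Ioc a b) := hwz
    rw [← integral_sub ((A (z a)).integrable_comp hwa) hwz', ← Real.norm_eq_abs]
    have := norm_setIntegral_le_of_norm_le_const (μ := volume) (s := Ioc a b)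
      (f := fun t => A (z a) (w (z a) t) - A (z t) (w (z t) t))
      (C := (1 * N + c * L) * l * M + L * (Λ * l)) (by simp) fun t ht => ?_
    · refine this.trans (le_of_eq ?_)
      simp [hba]
      ring
    · have hzt := hza t (Ioc_subset_Icc_self ht)
      rw [norm_sub_rev] at hzt
      have e : A (z a) (w (z a) t) - A (z t) (w (z t) t)
          = (A (z a) - A (z t)) (w (z a) t) + A (z t) (w (z a) t - w (z t) t) := by
        simp only [sub_apply, map_sub]; ring
      rw [e]
      refine (norm_add_le _ _).trans (add_le_add ?_ ?_)
      · refine (ContinuousLinearMap.le_opNorm _ _).trans (mul_le_mul ?_ (hwM t ht _)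
          (norm_nonneg _) (by positivity))
        exact (hχ.norm_smul_fderiv_sub_le hu hχ1 _ _).trans (by gcongr)
      · refine (ContinuousLinearMap.le_opNorm _ _).trans (mul_le_mul (hAL _) ?_
          (norm_nonneg _) hL)
        exact (hwΛ t ht _ _).trans (by gcongr)
  have e : (∫ t in Ioc a b, χ (z t) • fderiv ℝ u (z t) (w (z t) t))
      = ∫ t in Ioc a b, A (z t) (w (z t) t) := rfl
  rw [e]
  refine (abs_sub_le _ (A (z a) s) _).trans ?_
  have h4 := abs_sub_le (A (z a) s) (∫ t in Ioc a b, A (z a) (w (z a) t))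
    (∫ t in Ioc a b, A (z t) (w (z t) t))
  linarith

end PathEstimate

/-! ### One step of the dual scheme -/

section EulerStep

variable {d : ℕ} {μ : Measure (RR d)} [IsProbabilityMeasure μ]

theorem timeProd_restrict {a b : ℝ} (h : Ioc a b ⊆ Icc (0 : ℝ) 1) :
    (timeProd μ).restrict (Prod.snd ⁻¹' Ioc a b) = μ.prod (volume.restrict (Ioc a b)) := by
  have e : (Prod.snd ⁻¹' Ioc a b : Set (RR d × ℝ)) = univ ×ˢ Ioc a b := by ext p; simp
  rw [e, ← Measure.prod_restrict, Measure.restrict_univ,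
    Measure.restrict_restrict measurableSet_Ioc,
    inter_eq_left.2 h]

/-- One backward Euler step of the dual transport equation. The error consists of terms of higher
order in the step size, of the error `δ` of the displacement `s`, and of the mass that the cutoff
`χ` loses because of its gradient. -/
theorem IsWeakDrift.abs_sub_le_of_step {Z : CharMap μ} {v : RR d → ℝ → RR d}
    (hZ : IsWeakDrift Z v) {χ u : RR d → ℝ} {c Nχ L N U : ℝ} (hχ : IsC11 χ c Nχ)
    (hu : IsC11 u L N) (hχ1 : ∀ x, |χ x| ≤ 1) (hU : ∀ x, |u x| ≤ U) {w : RR d → ℝ → RR d}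
    {M Λ δ : ℝ} (hΛ : 0 ≤ Λ) (hM : 0 ≤ M) (hwm : Measurable (Function.uncurry w))
    (hwM : ∀ t ∈ Icc (0 : ℝ) 1, ∀ x, ‖w x t‖ ≤ M)
    (hwΛ : ∀ t ∈ Icc (0 : ℝ) 1, ∀ x y, ‖w x t - w y t‖ ≤ Λ * ‖x - y‖)
    (hwv : ∀ x t, χ x ≠ 0 → w x t = v x t) {a b : ℝ} (ha : 0 ≤ a) (hab : a ≤ b) (hb : b ≤ 1)
    {s : RR d → RR d} (hs : Continuous s) (hsM : ∀ x, ‖s x‖ ≤ (b - a) * M)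
    (hsδ : ∀ x, ‖s x - ∫ t in Ioc a b, w x t‖ ≤ (b - a) * δ) :
    |(∫ x, χ (Z.map x b) * u (Z.map x b) ∂μ)
        - ∫ x, χ (Z.map x a) * u (Z.map x a + s (Z.map x a)) ∂μ|
      ≤ (b - a) * ((2 * ((1 * N + c * L) + (U * Nχ + L * c)) + N * M ^ 2
            + ((1 * N + c * L) * M + L * Λ))
          * ((b - a) + ∫ p in Prod.snd ⁻¹' Ioc a b, ‖Z.vel p.1 p.2‖ ^ 2 ∂(timeProd μ)) + L * δ)
        + U * c * ∫ p in Prod.snd ⁻¹' Ioc a b, ‖v (Z.map p.1 p.2) p.2‖ ∂(timeProd μ) := by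
  have hsub : Ioc a b ⊆ Icc (0 : ℝ) 1 := fun t ht => ⟨ha.trans ht.1.le, ht.2.trans hb⟩
  have haI : a ∈ Icc (0 : ℝ) 1 := ⟨ha, hab.trans hb⟩
  have hbI : b ∈ Icc (0 : ℝ) 1 := ⟨ha.trans hab, hb⟩
  have hba : 0 ≤ b - a := sub_nonneg.2 hab
  have hN := hu.nonneg
  have hL := hu.nonneg_left
  have hc := hχ.nonneg_left
  have hNχ := hχ.nonneg
  have hU0 : 0 ≤ U := (abs_nonneg _).trans (hU 0)
  set P := μ.prod (volume.restrict (Ioc a b)) with hP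
  have hPt : (timeProd μ).restrict (Prod.snd ⁻¹' Ioc a b) = P := timeProd_restrict hsub
  have hPle : P ≤ timeProd μ := hPt ▸ Measure.restrict_le_self
  rw [hPt]
  set φ := fun x => χ x * u x with hφdef
  have hφ := hχ.mul hu hχ1 hU
  rw [← hφdef] at hφ
  have hφU : ∀ x y, |χ x * u y| ≤ U := fun x y => by
    rw [abs_mul]
    exact (mul_le_mul (hχ1 x) (hU y) (abs_nonneg _) zero_le_one).trans_eq (one_mul U)
  set Lφ := 1 * L + U * c
  set Nφ := (1 * N + c * L) + (U * Nχ + L * c) with hNφ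
  have hNφ0 : 0 ≤ Nφ := hφ.nonneg
  set B := (1 * N + c * L) * M + L * Λ with hB
  have hB0 : 0 ≤ B := by positivity
  have hVL : MemLp (fun p : RR d × ℝ => Z.vel p.1 p.2) 2 P := Z.memLp_vel.mono_measure hPle
  have iV : Integrable (fun p : RR d × ℝ => Z.vel p.1 p.2) P := hVL.integrable (by norm_num)
  have iV2 : Integrable (fun p : RR d × ℝ => ‖Z.vel p.1 p.2‖ ^ 2) P :=
    hVL.integrable_norm_pow (by norm_num)
  have iv : Integrable (fun p : RR d × ℝ => v (Z.map p.1 p.2) p.2) P :=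
    (hZ.memLp.mono_measure hPle).integrable (by norm_num)
  have hmap : AEStronglyMeasurable (fun p : RR d × ℝ => Z.map p.1 p.2) P :=
    Z.aestronglyMeasurable_map.mono_measure hPle
  have htime : ∀ᵐ p ∂P, p.2 ∈ Ioc a b :=
    Measure.quasiMeasurePreserving_snd.ae (ae_restrict_mem measurableSet_Ioc)
  have iw : Integrable (fun p : RR d × ℝ => w (Z.map p.1 p.2) p.2) P := by
    refine (integrable_const M).mono' ((Z.aestronglyMeasurable_comp hwm).mono_measure hPle) ?_
    filter_upwards [htime] with p hp
    exact hwM _ (hsub hp) _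
  have hDφm : AEStronglyMeasurable (fun p : RR d × ℝ => fderiv ℝ φ (Z.map p.1 p.2)) P :=
    hφ.continuous_fderiv.comp_aestronglyMeasurable hmap
  have hDum : AEStronglyMeasurable
      (fun p : RR d × ℝ => χ (Z.map p.1 p.2) • fderiv ℝ u (Z.map p.1 p.2)) P :=
    (hχ.differentiable.continuous.smul hu.continuous_fderiv).comp_aestronglyMeasurable hmap
  have hDuL : ∀ x, ‖χ x • fderiv ℝ u x‖ ≤ 1 * L := fun x => by
    rw [norm_smul, Real.norm_eq_abs]
    exact mul_le_mul (hχ1 x) (hu.norm_fderiv_le x) (norm_nonneg _) zero_le_one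
  have i1 : Integrable (fun p : RR d × ℝ => fderiv ℝ φ (Z.map p.1 p.2) (Z.vel p.1 p.2)) P :=
    integrable_clm_apply hDφm (fun _ => hφ.norm_fderiv_le _) iV
  have i1v : Integrable
      (fun p : RR d × ℝ => fderiv ℝ φ (Z.map p.1 p.2) (v (Z.map p.1 p.2) p.2)) P :=
    integrable_clm_apply hDφm (fun _ => hφ.norm_fderiv_le _) iv
  have i2 : Integrable (fun p : RR d × ℝ =>
      χ (Z.map p.1 p.2) • fderiv ℝ u (Z.map p.1 p.2) (w (Z.map p.1 p.2) p.2)) P :=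
    integrable_clm_apply hDum (fun _ => hDuL _) iw
  set l := fun x => ∫ t in Ioc a b, ‖Z.vel x t‖ with hl
  set k := fun x => ∫ t in Ioc a b, ‖Z.vel x t‖ ^ 2 with hk
  set I1 := fun x => ∫ t in Ioc a b, fderiv ℝ φ (Z.map x t) (Z.vel x t) with hI1
  set I2 := fun x => ∫ t in Ioc a b, χ (Z.map x t) • fderiv ℝ u (Z.map x t) (w (Z.map x t) t)
    with hI2
  set C := 2 * Nφ + N * M ^ 2 + B with hC
  have hC0 : 0 ≤ C := by positivity
  have hpath : ∀ᵐ x ∂μ,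
      ‖(φ (Z.map x b) - χ (Z.map x a) * u (Z.map x a + s (Z.map x a))) - (I1 x - I2 x)‖
        ≤ (b - a) * (C * ((b - a) + k x) + L * δ) := by
    filter_upwards [Z.ae_map_sub, Z.ae_memLp_vel, hmap.prodMk_left, i2.prod_right_ae]
      with x hx1 hx2 hx3 hx4
    have hxL : MemLp (Z.vel x) 2 (volume.restrict (Ioc a b)) :=
      hx2.mono_measure (Measure.restrict_mono_set _ hsub)
    have hxi : IntegrableOn (Z.vel x) (Ioc a b) := hxL.integrable (by norm_num)
    have hz : ∀ t ∈ Icc a b, Z.map x t - Z.map x a = ∫ r in Ioc a t, Z.vel x r := fun t ht => by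
      rw [hx1 a haI t ⟨ha.trans ht.1, ht.2.trans hb⟩, intervalIntegral.integral_of_le ht.1]
    have e1 := hφ.path_expansion hab hxi hx3 hz
    have hwa : IntegrableOn (fun t => w (Z.map x a) t) (Ioc a b) := by
      refine Measure.integrableOn_of_bounded (M := M) (by simp)
        (hwm.comp measurable_prodMk_left).aestronglyMeasurable ?_
      filter_upwards [ae_restrict_mem measurableSet_Ioc] with t ht
      exact hwM t (hsub ht) _
    have e2 := hχ.displacement_expansion hu hχ1 hab hxi hz hΛ hwa hx4
      (fun t ht => hwM t (hsub ht)) (fun t ht => hwΛ t (hsub ht)) (hsM (Z.map x a))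
      (hsδ (Z.map x a))
    have e3 : l x ^ 2 ≤ (b - a) * k x := sq_integral_norm_le hab hxL
    have e4 : l x ≤ (b - a) + k x := by
      have hx5 : IntegrableOn (fun t => ‖Z.vel x t‖ ^ 2) (Ioc a b) :=
        hxL.integrable_norm_pow (by norm_num)
      have : (b - a) + k x = ∫ t in Ioc a b, (1 + ‖Z.vel x t‖ ^ 2) := by
        rw [integral_add (integrable_const _) hx5]; simp [hk, hba]
      rw [this]
      refine integral_mono hxi.norm ((integrable_const _).add hx5) fun t => ?_
      simp only
      nlinarith [sq_nonneg (‖Z.vel x t‖ - 1), norm_nonneg (Z.vel x t)]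
    have hk0 : 0 ≤ k x := integral_nonneg fun _ => sq_nonneg _
    rw [Real.norm_eq_abs]
    have e5 : (φ (Z.map x b) - χ (Z.map x a) * u (Z.map x a + s (Z.map x a))) - (I1 x - I2 x)
        = (φ (Z.map x b) - φ (Z.map x a) - I1 x)
          - (χ (Z.map x a) * (u (Z.map x a + s (Z.map x a)) - u (Z.map x a)) - I2 x) := by
      simp only [hφdef]; ring
    rw [e5]
    refine (abs_sub _ _).trans ((add_le_add e1 e2).trans ?_)
    have f1 : 2 * Nφ * l x ^ 2 ≤ 2 * Nφ * ((b - a) * k x) := by gcongr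
    have f2 : (b - a) * B * l x ≤ (b - a) * B * ((b - a) + k x) := by gcongr
    have f3 : 0 ≤ (b - a) * (2 * Nφ * (b - a)) := by positivity
    have f4 : 0 ≤ (b - a) * (N * M ^ 2 * k x) := by positivity
    calc _ ≤ 2 * Nφ * ((b - a) * k x) + (N * ((b - a) * M) ^ 2 + L * ((b - a) * δ)
          + (b - a) * B * ((b - a) + k x)) := by
          exact add_le_add f1 (add_le_add le_rfl f2)
      _ ≤ _ := by
          rw [hC]
          linarith
  have ik : Integrable k μ := iV2.integral_prod_left
  have iI1 : Integrable I1 μ := i1.integral_prod_left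
  have iI2 : Integrable I2 μ := i2.integral_prod_left
  have hcχ := hχ.differentiable.continuous
  have hcu := hu.differentiable.continuous
  have ib : Integrable (fun x => φ (Z.map x b)) μ := by
    refine (integrable_const U).mono' ((hcχ.mul hcu).comp_aestronglyMeasurable
      (Z.aestronglyMeasurable_map_time hbI)) (ae_of_all _ fun x => hφU _ _)
  have ia : Integrable (fun x => χ (Z.map x a) * u (Z.map x a + s (Z.map x a))) μ := by
    refine (integrable_const U).mono' ((hcχ.mul (hcu.comp (continuous_id.add
      hs))).comp_aestronglyMeasurable (Z.aestronglyMeasurable_map_time haI))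
      (ae_of_all _ fun x => hφU _ _)
  have hmain : |(∫ x, φ (Z.map x b) ∂μ)
      - (∫ x, χ (Z.map x a) * u (Z.map x a + s (Z.map x a)) ∂μ) - (∫ x, (I1 x - I2 x) ∂μ)|
      ≤ (b - a) * (C * ((b - a) + ∫ p, ‖Z.vel p.1 p.2‖ ^ 2 ∂P) + L * δ) := by
    rw [← integral_sub ib ia, ← integral_sub
      (f := fun x => φ (Z.map x b) - χ (Z.map x a) * u (Z.map x a + s (Z.map x a)))
      (g := fun x => I1 x - I2 x) (ib.sub ia) (iI1.sub iI2), ← Real.norm_eq_abs]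
    refine (norm_integral_le_of_norm_le (((((integrable_const (b - a)).add ik).const_mul C).add
      (integrable_const (L * δ))).const_mul (b - a)) hpath).trans (le_of_eq ?_)
    have e : (∫ p, ‖Z.vel p.1 p.2‖ ^ 2 ∂P) = ∫ x, k x ∂μ := integral_prod _ iV2
    rw [e, integral_const_mul]
    simp only [Pi.add_apply]
    rw [integral_add (f := fun x => C * (b - a + k x)) (((integrable_const (b - a)).add
      ik).const_mul C) (integrable_const _), integral_const_mul, integral_add (integrable_const _)
      ik]
    simp
  -- `η` is the gradient of `φ`, switched on during the step; testing the drift with it replaces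
  -- `∂ₜZ` by `v` in expectation
  have hdrift : ∫ p, fderiv ℝ φ (Z.map p.1 p.2) (Z.vel p.1 p.2) ∂P
      = ∫ p, fderiv ℝ φ (Z.map p.1 p.2) (v (Z.map p.1 p.2) p.2) ∂P := by
    let η : RR d → ℝ → RR d := fun x t => (Ioc a b).indicator (fun _ => gradient φ x) t
    have hgc : Continuous (gradient φ) :=
      (InnerProductSpace.toDual ℝ (RR d)).symm.continuous.comp hφ.continuous_fderiv
    have hη : Measurable (Function.uncurry η) := by
      have : Function.uncurry η
          = (Prod.snd ⁻¹' Ioc a b).indicator (fun p : RR d × ℝ => gradient φ p.1) := by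
        ext1 p; simp only [η, Function.uncurry, indicator, mem_preimage]
      rw [this]
      exact (hgc.measurable.comp measurable_fst).indicator (measurable_snd measurableSet_Ioc)
    have hηb : ∀ x t, ‖η x t‖ ≤ Lφ := fun x t => by
      refine (norm_indicator_le_norm_self _ _).trans ?_
      rw [gradient, LinearIsometryEquiv.norm_map]
      exact hφ.norm_fderiv_le x
    have h0 := hZ.integral_inner_eq_zero η hη (MemLp.of_bound (Z.aestronglyMeasurable_comp hη) Lφ
      (ae_of_all _ fun p => hηb _ _))
    have e : ∀ p : RR d × ℝ, inner ℝ (η (Z.map p.1 p.2) p.2)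
        (Z.vel p.1 p.2 - v (Z.map p.1 p.2) p.2)
        = (Prod.snd ⁻¹' Ioc a b).indicator (fun p : RR d × ℝ =>
          fderiv ℝ φ (Z.map p.1 p.2) (Z.vel p.1 p.2)
            - fderiv ℝ φ (Z.map p.1 p.2) (v (Z.map p.1 p.2) p.2)) p := by
      intro p
      by_cases hp : p.2 ∈ Ioc a b
      · rw [indicator_of_mem (s := Prod.snd ⁻¹' Ioc a b) hp, ← map_sub]
        simp only [η, indicator_of_mem hp, gradient, InnerProductSpace.toDual_symm_apply]
      · rw [indicator_of_notMem (s := Prod.snd ⁻¹' Ioc a b) hp]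
        simp only [η, indicator_of_notMem hp, inner_zero_left]
    simp only [e] at h0
    rw [integral_indicator (measurable_snd measurableSet_Ioc), hPt, integral_sub i1 i1v] at h0
    exact sub_eq_zero.1 h0
  have hI : |∫ x, (I1 x - I2 x) ∂μ| ≤ U * c * ∫ p, ‖v (Z.map p.1 p.2) p.2‖ ∂P := by
    rw [integral_sub iI1 iI2, ← integral_prod _ i1, ← integral_prod _ i2, hdrift,
      ← integral_sub i1v i2, ← Real.norm_eq_abs, ← integral_const_mul]
    refine norm_integral_le_of_norm_le (iv.norm.const_mul _) (ae_of_all _ fun p => ?_)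
    set z := Z.map p.1 p.2
    have e : fderiv ℝ φ z (v z p.2) - χ z • fderiv ℝ u z (w z p.2)
        = u z * fderiv ℝ χ z (v z p.2) := by
      rw [hφdef, hχ.fderiv_mul' hu]
      simp only [add_apply, smul_apply, smul_eq_mul]
      rcases eq_or_ne (χ z) 0 with h | h
      · simp [h]
      · rw [hwv z p.2 h]; ring
    simp only [e]
    rw [norm_mul, mul_assoc, Real.norm_eq_abs]
    refine mul_le_mul (hU z) ?_ (norm_nonneg _) hU0
    exact (ContinuousLinearMap.le_opNorm _ _).trans
      (mul_le_mul_of_nonneg_right (hχ.norm_fderiv_le z) (norm_nonneg _))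
  have := abs_sub_abs_le_abs_sub ((∫ x, φ (Z.map x b) ∂μ)
      - ∫ x, χ (Z.map x a) * u (Z.map x a + s (Z.map x a)) ∂μ) (∫ x, (I1 x - I2 x) ∂μ)
  linarith

end EulerStep

/-! ### The dual Euler scheme -/

section EulerScheme

variable {d : ℕ} {μ : Measure (RR d)} [IsProbabilityMeasure μ]

/-- `n` backward Euler steps: one terminal function `ψ` and one time `T` give a function `u` at
time `0` that serves every trajectory with the drift `v`. -/
theorem exists_dual_scheme {v w : RR d → ℝ → RR d} {χ ψ : RR d → ℝ} {c Nχ L₀ N₀ U M Λ ε C : ℝ}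
    (hχ : IsC11 χ c Nχ) (hχ1 : ∀ x, |χ x| ≤ 1) (hψ : IsC11 ψ L₀ N₀) (hU : ∀ x, |ψ x| ≤ U)
    (hΛ : 0 ≤ Λ) (hM : 0 ≤ M) (hC : 0 ≤ C) (hwm : Measurable (Function.uncurry w))
    (hwM : ∀ t ∈ Icc (0 : ℝ) 1, ∀ x, ‖w x t‖ ≤ M)
    (hwΛ : ∀ t ∈ Icc (0 : ℝ) 1, ∀ x y, ‖w x t - w y t‖ ≤ Λ * ‖x - y‖)
    (hwv : ∀ x t, χ x ≠ 0 → w x t = v x t)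
    (hmol : ∀ (f : RR d → RR d) (M K : ℝ), 0 ≤ M → 0 ≤ K → (∀ x, ‖f x‖ ≤ M) →
      (∀ x y, ‖f x - f y‖ ≤ K * ‖x - y‖) →
      ∃ s : RR d → RR d, IsC11 s K (C * M) ∧ (∀ x, ‖s x‖ ≤ M) ∧ ∀ x, ‖s x - f x‖ ≤ K * ε)
    {T h : ℝ} (hT : T ≤ 1) (hh : 0 ≤ h) {L N : ℝ} {n : ℕ} (hn : n * h ≤ T)
    (hL : L₀ * (1 + h * Λ) ^ n ≤ L)
    (hN : (1 + h * Λ) ^ (2 * n) * (N₀ + n * h * (C * M * L₀)) ≤ N) (j : ℕ) (hj : j ≤ n) :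
    ∃ u : RR d → ℝ, (∀ x, |u x| ≤ U) ∧
      IsC11 u (L₀ * (1 + h * Λ) ^ j) ((1 + h * Λ) ^ (2 * j) * (N₀ + j * h * (C * M * L₀))) ∧
      ∀ Z : CharMap μ, IsWeakDrift Z v →
        |(∫ x, χ (Z.map x T) * ψ (Z.map x T) ∂μ)
          - ∫ x, χ (Z.map x (T - j * h)) * u (Z.map x (T - j * h)) ∂μ|
        ≤ h * ((2 * ((1 * N + c * L) + (U * Nχ + L * c)) + N * M ^ 2
            + ((1 * N + c * L) * M + L * Λ))
          * (j * h + ∫ p in Prod.snd ⁻¹' Ioc (T - j * h) T, ‖Z.vel p.1 p.2‖ ^ 2 ∂(timeProd μ))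
            + j * (L * (Λ * ε)))
        + U * c * ∫ p in Prod.snd ⁻¹' Ioc (T - j * h) T,
            ‖v (Z.map p.1 p.2) p.2‖ ∂(timeProd μ) := by
  have hL₀ := hψ.nonneg_left
  have hN₀ := hψ.nonneg
  have hq : 1 ≤ 1 + h * Λ := by nlinarith [mul_nonneg hh hΛ]
  have hq0 : 0 ≤ 1 + h * Λ := zero_le_one.trans hq
  induction j with
  | zero => exact ⟨ψ, hU, by simpa using hψ, fun Z _ => by simp⟩
  | succ j ih =>
    obtain ⟨u, huU, hu, hest⟩ := ih (Nat.le_of_succ_le hj)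
    set b := T - j * h with hb
    set a := T - (j + 1 : ℕ) * h with ha
    have hba : b - a = h := by rw [ha, hb]; push_cast; ring
    have hab : a ≤ b := by linarith
    have ha0 : 0 ≤ a := by
      have : ((j + 1 : ℕ) : ℝ) * h ≤ n * h := by gcongr
      linarith
    have hjh : 0 ≤ (j : ℝ) * h := by positivity
    have hb1 : b ≤ 1 := by linarith
    have hbT : b ≤ T := by linarith
    have hsub : Ioc a b ⊆ Icc (0 : ℝ) 1 := fun t ht => ⟨ha0.trans ht.1.le, ht.2.trans hb1⟩
    have hiw : ∀ x, IntegrableOn (fun t => w x t) (Ioc a b) := fun x => by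
      refine Measure.integrableOn_of_bounded (M := M) (by simp)
        (hwm.comp measurable_prodMk_left).aestronglyMeasurable ?_
      filter_upwards [ae_restrict_mem measurableSet_Ioc] with t ht
      exact hwM t (hsub ht) _
    have hvol : volume.real (Ioc a b) = h := by
      rw [Measure.real, Real.volume_Ioc, hba, ENNReal.toReal_ofReal hh]
    obtain ⟨s, hs, hsM, hsδ⟩ := hmol (fun x => ∫ t in Ioc a b, w x t) (h * M) (h * Λ)
      (by positivity) (by positivity)
      (fun x => by
        have := norm_setIntegral_le_of_norm_le_const (μ := volume) (s := Ioc a b) (by simp)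
          fun t ht => hwM t (hsub ht) x
        rwa [hvol, mul_comm] at this)
      (fun x y => by
        rw [← integral_sub (hiw x) (hiw y)]
        have := norm_setIntegral_le_of_norm_le_const (μ := volume) (s := Ioc a b) (by simp)
          fun t ht => hwΛ t (hsub ht) x y
        rw [hvol] at this
        exact this.trans (le_of_eq (by ring)))
    have hpow : (1 + h * Λ) ^ j ≤ (1 + h * Λ) ^ n :=
      pow_le_pow_right₀ hq (Nat.le_of_succ_le hj)
    have hpow2 : (1 + h * Λ) ^ (2 * j) ≤ (1 + h * Λ) ^ (2 * n) :=
      pow_le_pow_right₀ hq (by omega)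
    have hjn : (j : ℝ) ≤ n := by exact_mod_cast Nat.le_of_succ_le hj
    have huLN : IsC11 u L N := by
      refine hu.mono ((mul_le_mul_of_nonneg_left hpow hL₀).trans hL) (le_trans ?_ hN)
      gcongr
    refine ⟨fun x => u (x + s x), fun x => huU _, ?_, fun Z hZ => ?_⟩
    · refine (hu.comp_id_add hs).mono (le_of_eq (by ring)) ?_
      have h1 : (1 + h * Λ) ^ j ≤ (1 + h * Λ) ^ (2 * (j + 1)) :=
        pow_le_pow_right₀ hq (by omega)
      have h2 : L₀ * (1 + h * Λ) ^ j * (C * (h * M))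
          ≤ L₀ * (1 + h * Λ) ^ (2 * (j + 1)) * (C * (h * M)) := by gcongr
      have e : (1 + h * Λ) ^ (2 * (j + 1)) = (1 + h * Λ) ^ (2 * j) * (1 + h * Λ) ^ 2 := by ring
      refine (add_le_add le_rfl h2).trans (le_of_eq ?_)
      rw [e]
      push_cast
      ring
    · have h1 := hest Z hZ
      have h2 := hZ.abs_sub_le_of_step hχ huLN hχ1 huU hΛ hM hwm hwM hwΛ hwv ha0 hab hb1
        hs.differentiable.continuous (fun x => by rw [hba]; exact hsM x)
        (δ := Λ * ε) (fun x => by rw [hba, ← mul_assoc]; exact hsδ x)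
      have iV : Integrable (fun p : RR d × ℝ => ‖Z.vel p.1 p.2‖ ^ 2) (timeProd μ) :=
        Z.memLp_vel.integrable_norm_pow (by norm_num)
      have iv : Integrable (fun p : RR d × ℝ => ‖v (Z.map p.1 p.2) p.2‖) (timeProd μ) :=
        (hZ.memLp.integrable (by norm_num)).norm
      have hunion : (Prod.snd ⁻¹' Ioc a T : Set (RR d × ℝ))
          = Prod.snd ⁻¹' Ioc a b ∪ Prod.snd ⁻¹' Ioc b T := by
        rw [← preimage_union, Ioc_union_Ioc_eq_Ioc hab hbT]
      have hdisj : Disjoint (Prod.snd ⁻¹' Ioc a b : Set (RR d × ℝ)) (Prod.snd ⁻¹' Ioc b T) :=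
        (Ioc_disjoint_Ioc_of_le le_rfl).preimage _
      have hm : MeasurableSet (Prod.snd ⁻¹' Ioc b T : Set (RR d × ℝ)) :=
        measurable_snd measurableSet_Ioc
      rw [hunion, setIntegral_union hdisj hm iV.integrableOn iV.integrableOn,
        setIntegral_union hdisj hm iv.integrableOn iv.integrableOn]
      rw [hba] at h2
      refine (abs_sub_le _ _ _).trans ((add_le_add h1 h2).trans (le_of_eq ?_))
      push_cast
      ring

end EulerScheme

/-! ### Uniqueness for the continuity equation -/

section LawEquality

variable {d : ℕ} {μ : Measure (RR d)} [IsProbabilityMeasure μ]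

/-- Two trajectories with the same drift have the same localized expectations up to the mass that
the drift carries across the region where the cutoff `χ` varies. -/
theorem IsWeakDrift.abs_integral_cutoff_sub_le {X Y : CharMap μ} {v w : RR d → ℝ → RR d}
    (hX : IsWeakDrift X v) (hY : IsWeakDrift Y v) {χ ψ : RR d → ℝ} {c Nχ L₀ N₀ U M Λ : ℝ}
    (hχ : IsC11 χ c Nχ) (hχ1 : ∀ x, |χ x| ≤ 1) (hψ : IsC11 ψ L₀ N₀) (hU : ∀ x, |ψ x| ≤ U)
    (hΛ : 0 ≤ Λ) (hM : 0 ≤ M) (hwm : Measurable (Function.uncurry w))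
    (hwM : ∀ t ∈ Icc (0 : ℝ) 1, ∀ x, ‖w x t‖ ≤ M)
    (hwΛ : ∀ t ∈ Icc (0 : ℝ) 1, ∀ x y, ‖w x t - w y t‖ ≤ Λ * ‖x - y‖)
    (hwv : ∀ x t, χ x ≠ 0 → w x t = v x t) {T : ℝ} (hT : T ∈ Icc (0 : ℝ) 1) :
    |(∫ x, χ (X.map x T) * ψ (X.map x T) ∂μ) - ∫ x, χ (Y.map x T) * ψ (Y.map x T) ∂μ|
      ≤ U * c * ((∫ p, ‖v (X.map p.1 p.2) p.2‖ ∂(timeProd μ))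
        + ∫ p, ‖v (Y.map p.1 p.2) p.2‖ ∂(timeProd μ)) := by
  have hL₀ := hψ.nonneg_left
  have hN₀ := hψ.nonneg
  have hc := hχ.nonneg_left
  have hNχ := hχ.nonneg
  have hU0 : 0 ≤ U := (abs_nonneg _).trans (hU 0)
  set D := |(∫ x, χ (X.map x T) * ψ (X.map x T) ∂μ) - ∫ x, χ (Y.map x T) * ψ (Y.map x T) ∂μ|
  set q := fun Z : CharMap μ => ∫ p, ‖v (Z.map p.1 p.2) p.2‖ ∂(timeProd μ)
  set m := fun Z : CharMap μ => ∫ p, ‖Z.vel p.1 p.2‖ ^ 2 ∂(timeProd μ)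
  set L := L₀ * Real.exp Λ with hL
  have hL0 : 0 ≤ L := by positivity
  -- the step size tends to zero before `ε` does, since `C`, hence `N`, depends on `ε`
  have hstep : ∀ ε : ℝ, 0 < ε → D ≤ 2 * (L * (Λ * ε)) + U * c * (q X + q Y) := by
    intro ε hε
    obtain ⟨C, hC, hmol⟩ := exists_mollification (E := RR d) hε
    set N := Real.exp (2 * Λ) * (N₀ + C * M * L₀) with hN
    have hN0 : 0 ≤ N := by positivity
    set A := 2 * ((1 * N + c * L) + (U * Nχ + L * c)) + N * M ^ 2 + ((1 * N + c * L) * M + L * Λ)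
    have hA : 0 ≤ A := by positivity
    have hn : ∀ n : ℕ, D ≤ A * (2 + m X + m Y) / ((n + 1 : ℕ) : ℝ)
        + (2 * (L * (Λ * ε)) + U * c * (q X + q Y)) := by
      intro n
      set h := T / ((n + 1 : ℕ) : ℝ) with hh
      have hn0 : (0 : ℝ) < ((n + 1 : ℕ) : ℝ) := by positivity
      have hh0 : 0 ≤ h := div_nonneg hT.1 hn0.le
      have hnh : ((n + 1 : ℕ) : ℝ) * h = T := by rw [hh]; field_simp
      have hq0 : 0 ≤ 1 + h * Λ := by nlinarith [mul_nonneg hh0 hΛ]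
      have hexp : (1 + h * Λ) ^ (n + 1) ≤ Real.exp Λ := by
        calc (1 + h * Λ) ^ (n + 1) ≤ Real.exp (h * Λ) ^ (n + 1) := by
              refine pow_le_pow_left₀ hq0 ?_ _
              rw [add_comm]; exact Real.add_one_le_exp _
          _ = Real.exp (((n + 1 : ℕ) : ℝ) * (h * Λ)) := (Real.exp_nat_mul _ _).symm
          _ ≤ Real.exp Λ := by
              rw [← mul_assoc, hnh]
              exact Real.exp_le_exp.2 (mul_le_of_le_one_left hΛ hT.2)
      have hexp2 : (1 + h * Λ) ^ (2 * (n + 1)) ≤ Real.exp (2 * Λ) := by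
        have e : Real.exp (2 * Λ) = Real.exp Λ ^ 2 := by
          rw [← Real.exp_nat_mul]; norm_num
        rw [mul_comm 2 (n + 1), pow_mul, e]
        exact pow_le_pow_left₀ (pow_nonneg hq0 _) hexp 2
      obtain ⟨u, -, -, hest⟩ := exists_dual_scheme (μ := μ) (L := L) (N := N) hχ hχ1 hψ hU hΛ hM
        hC hwm hwM hwΛ hwv hmol hT.2 hh0 hnh.le (mul_le_mul_of_nonneg_left hexp hL₀)
        (by
          rw [hnh]
          have : T * (C * M * L₀) ≤ C * M * L₀ := mul_le_of_le_one_left (by positivity) hT.2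
          have hT0 := hT.1
          exact mul_le_mul hexp2 (by linarith) (by positivity) (Real.exp_pos _).le) (n + 1) le_rfl
      have hZ : ∀ Z : CharMap μ, IsWeakDrift Z v →
          |(∫ x, χ (Z.map x T) * ψ (Z.map x T) ∂μ) - ∫ x, χ x * u x ∂μ|
          ≤ A * (1 + m Z) / ((n + 1 : ℕ) : ℝ) + L * (Λ * ε) + U * c * q Z := by
        intro Z hZ
        have h1 := hest Z hZ
        rw [hnh, sub_self] at h1
        have e0 : ∫ x, χ (Z.map x 0) * u (Z.map x 0) ∂μ = ∫ x, χ x * u x ∂μ := by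
          refine integral_congr_ae ?_
          filter_upwards [Z.map_eq] with x hx
          have := hx 0 ⟨le_rfl, zero_le_one⟩
          rw [intervalIntegral.integral_same, add_zero] at this
          simp only [this]
        rw [e0] at h1
        have iV : Integrable (fun p : RR d × ℝ => ‖Z.vel p.1 p.2‖ ^ 2) (timeProd μ) :=
          Z.memLp_vel.integrable_norm_pow (by norm_num)
        have iv : Integrable (fun p : RR d × ℝ => ‖v (Z.map p.1 p.2) p.2‖) (timeProd μ) :=
          (hZ.memLp.integrable (by norm_num)).norm
        have h2 : ∫ p in Prod.snd ⁻¹' Ioc 0 T, ‖Z.vel p.1 p.2‖ ^ 2 ∂(timeProd μ) ≤ m Z :=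
          setIntegral_le_integral iV (ae_of_all _ fun _ => sq_nonneg _)
        have h3 : ∫ p in Prod.snd ⁻¹' Ioc 0 T, ‖v (Z.map p.1 p.2) p.2‖ ∂(timeProd μ) ≤ q Z :=
          setIntegral_le_integral iv (ae_of_all _ fun _ => norm_nonneg _)
        have h4 : h ≤ 1 / ((n + 1 : ℕ) : ℝ) := by rw [hh]; gcongr; exact hT.2
        have hm0 : 0 ≤ m Z := integral_nonneg fun _ => sq_nonneg _
        have h5 : h * (A * (T + ∫ p in Prod.snd ⁻¹' Ioc 0 T, ‖Z.vel p.1 p.2‖ ^ 2 ∂(timeProd μ)))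
            ≤ 1 / ((n + 1 : ℕ) : ℝ) * (A * (1 + m Z)) := by
          have hi0 : 0 ≤ ∫ p in Prod.snd ⁻¹' Ioc 0 T, ‖Z.vel p.1 p.2‖ ^ 2 ∂(timeProd μ) :=
            integral_nonneg fun _ => sq_nonneg _
          have hT0 := hT.1
          have hT1 := hT.2
          gcongr
        have h6 : h * (((n + 1 : ℕ) : ℝ) * (L * (Λ * ε))) ≤ L * (Λ * ε) := by
          rw [← mul_assoc, mul_comm h, hnh]
          exact mul_le_of_le_one_left (by positivity) hT.2
        have h7 := mul_le_mul_of_nonneg_left h3 (mul_nonneg hU0 hc)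
        rw [mul_add] at h1
        refine h1.trans ?_
        have e : A * (1 + m Z) / ((n + 1 : ℕ) : ℝ) = 1 / ((n + 1 : ℕ) : ℝ) * (A * (1 + m Z)) := by
          ring
        rw [e]
        linarith
      have hX' := hZ X hX
      have hY' := hZ Y hY
      rw [abs_sub_comm] at hY'
      refine (abs_sub_le _ (∫ x, χ x * u x ∂μ) _).trans ((add_le_add hX' hY').trans (le_of_eq ?_))
      ring
    refine ge_of_tendsto' (x := Filter.atTop) ?_ hn
    have h0 := (tendsto_const_div_atTop_nhds_zero_nat (A * (2 + m X + m Y))).comp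
      (Filter.tendsto_add_atTop_nat 1)
    simpa using h0.add_const (2 * (L * (Λ * ε)) + U * c * (q X + q Y))
  refine le_of_forall_pos_le_add fun δ hδ => ?_
  have hK : 0 < 2 * L * Λ + 1 := by positivity
  have h1 := hstep (δ / (2 * L * Λ + 1)) (by positivity)
  have h2 : 2 * (L * (Λ * (δ / (2 * L * Λ + 1)))) ≤ δ := by
    have e : 2 * (L * (Λ * (δ / (2 * L * Λ + 1)))) = δ * (2 * L * Λ / (2 * L * Λ + 1)) := by ring
    rw [e]
    refine mul_le_of_le_one_right hδ.le ((div_le_one hK).2 (by linarith))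
  linarith

/-- A smooth cutoff at radius `R`, with gradient of size `1 / R`. -/
theorem exists_cutoff (d : ℕ) : ∃ (c N : ℝ), ∀ R : ℝ, 0 < R → ∃ χ : RR d → ℝ,
    IsC11 χ (c / R) (N / R ^ 2) ∧ (∀ x, |χ x| ≤ 1) ∧ (∀ x, ‖x‖ ≤ R → χ x = 1) ∧
      ∀ x, 2 * R ≤ ‖x‖ → χ x = 0 := by
  let φ : ContDiffBump (0 : RR d) := ⟨1, 2, by norm_num, by norm_num⟩
  have hφ : ContDiff ℝ 2 φ := φ.contDiff
  have hφs : HasCompactSupport φ := φ.hasCompactSupport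
  have hφ' : ContDiff ℝ 1 (fderiv ℝ φ) := hφ.fderiv_right (by norm_num)
  obtain ⟨c, hc⟩ := hφ'.continuous.bounded_above_of_compact_support (hφs.fderiv ℝ)
  obtain ⟨N, hN⟩ := hφ'.lipschitzWith_of_hasCompactSupport (hφs.fderiv ℝ) (by norm_num)
  refine ⟨c, N, fun R hR => ⟨fun x => φ (R⁻¹ • x), ⟨?_, by positivity, fun x => ?_, fun x y => ?_⟩,
    fun x => ?_, fun x hx => ?_, fun x hx => ?_⟩⟩
  · exact (hφ.differentiable (by norm_num)).comp (differentiable_id.const_smul R⁻¹)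
  · rw [fderiv_comp_smul, norm_smul, Real.norm_of_nonneg (inv_nonneg.2 hR.le), div_eq_inv_mul]
    exact mul_le_mul_of_nonneg_left (hc _) (inv_nonneg.2 hR.le)
  · rw [fderiv_comp_smul, fderiv_comp_smul, ← smul_sub, norm_smul,
      Real.norm_of_nonneg (inv_nonneg.2 hR.le)]
    have h1 := hN.dist_le_mul (R⁻¹ • x) (R⁻¹ • y)
    rw [dist_eq_norm, dist_eq_norm, ← smul_sub, norm_smul,
      Real.norm_of_nonneg (inv_nonneg.2 hR.le)] at h1
    refine (mul_le_mul_of_nonneg_left h1 (inv_nonneg.2 hR.le)).trans (le_of_eq ?_)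
    field_simp
  · rw [abs_of_nonneg φ.nonneg]; exact φ.le_one
  · refine φ.one_of_mem_closedBall ?_
    rw [mem_closedBall_zero_iff, norm_smul, Real.norm_of_nonneg (inv_nonneg.2 hR.le),
      inv_mul_le_iff₀ hR]
    simpa [φ] using hx
  · refine φ.zero_of_le_dist ?_
    rw [dist_zero_right, norm_smul, Real.norm_of_nonneg (inv_nonneg.2 hR.le), le_inv_mul_iff₀ hR]
    simpa [φ, mul_comm] using hx

/-- Multiplication by a compactly supported cutoff makes a regular field globally bounded and
globally Lipschitz. -/
theorem IsRegularField.exists_bounds_smul {v : RR d → ℝ → RR d} (hv : IsRegularField v)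
    {κ : RR d → ℝ} {c N r : ℝ} (hκ : IsC11 κ c N) (hκ1 : ∀ x, |κ x| ≤ 1)
    (hκ0 : ∀ x, r ≤ ‖x‖ → κ x = 0) :
    ∃ M Λ : ℝ, 0 ≤ M ∧ 0 ≤ Λ ∧ (∀ t ∈ Icc (0 : ℝ) 1, ∀ x, ‖κ x • v x t‖ ≤ M) ∧
      ∀ t ∈ Icc (0 : ℝ) 1, ∀ x y, ‖κ x • v x t - κ y • v y t‖ ≤ Λ * ‖x - y‖ := by
  obtain ⟨⟨M, hM⟩, K, hK⟩ := hv.2 (Metric.closedBall 0 r) (isCompact_closedBall 0 r)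
  have hc := hκ.nonneg_left
  have hM' : ∀ t ∈ Icc (0 : ℝ) 1, ∀ x ∈ Metric.closedBall (0 : RR d) r, ‖v x t‖ ≤ max M 0 :=
    fun t ht x hx => (hM t ht x hx).trans (le_max_left _ _)
  have hout : ∀ x, x ∉ Metric.closedBall (0 : RR d) r → κ x = 0 := fun x hx =>
    hκ0 x (by simpa using (not_le.1 (fun h => hx (mem_closedBall_zero_iff.2 h))).le)
  -- the estimate at a point of the ball does not need the other point to lie in the ball
  have key : ∀ t ∈ Icc (0 : ℝ) 1, ∀ x ∈ Metric.closedBall (0 : RR d) r, ∀ y,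
      ‖κ x • v x t - κ y • v y t‖ ≤ (K + c * max M 0) * ‖x - y‖ := by
    intro t ht x hx y
    have hκl : |κ x - κ y| ≤ c * ‖x - y‖ := by
      rw [← Real.norm_eq_abs]; exact hκ.norm_sub_le y x
    have h1 : ‖(κ x - κ y) • v x t‖ ≤ c * ‖x - y‖ * max M 0 := by
      rw [norm_smul, Real.norm_eq_abs]
      exact mul_le_mul hκl (hM' t ht x hx) (norm_nonneg _) (by positivity)
    by_cases hy : y ∈ Metric.closedBall (0 : RR d) r
    · have h2 : ‖κ y • (v x t - v y t)‖ ≤ 1 * (K * ‖x - y‖) := by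
        rw [norm_smul, Real.norm_eq_abs]
        refine mul_le_mul (hκ1 y) ?_ (norm_nonneg _) zero_le_one
        rw [← dist_eq_norm, ← dist_eq_norm]
        exact (hK t ht).dist_le_mul x hx y hy
      have e : κ x • v x t - κ y • v y t = (κ x - κ y) • v x t + κ y • (v x t - v y t) := by
        module
      rw [e]
      refine (norm_add_le _ _).trans ?_
      linarith
    · have e : κ x • v x t - κ y • v y t = (κ x - κ y) • v x t := by
        rw [hout y hy]; simp
      rw [e]
      have : 0 ≤ (K : ℝ) * ‖x - y‖ := by positivity
      linarith
  refine ⟨max M 0, K + c * max M 0, le_max_right _ _, by positivity, fun t ht x => ?_,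
    fun t ht x y => ?_⟩
  · by_cases hx : x ∈ Metric.closedBall (0 : RR d) r
    · rw [norm_smul, Real.norm_eq_abs]
      exact (mul_le_mul (hκ1 x) (hM' t ht x hx) (norm_nonneg _) zero_le_one).trans_eq (one_mul _)
    · rw [hout x hx]; simp
  · by_cases hx : x ∈ Metric.closedBall (0 : RR d) r
    · exact key t ht x hx y
    · by_cases hy : y ∈ Metric.closedBall (0 : RR d) r
      · rw [norm_sub_rev, norm_sub_rev x]
        exact key t ht y hy x
      · rw [hout x hx, hout y hy]
        simp only [zero_smul, sub_self, norm_zero]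
        positivity

/-- The cutoff radius is sent to infinity. The field is truncated by a cutoff that equals one on the
support of the first cutoff, so that the truncation is invisible there. -/
theorem IsWeakDrift.integral_eq {X Y : CharMap μ} {v : RR d → ℝ → RR d} (hv : IsRegularField v)
    (hX : IsWeakDrift X v) (hY : IsWeakDrift Y v) {ψ : RR d → ℝ} {L₀ N₀ U : ℝ}
    (hψ : IsC11 ψ L₀ N₀) (hU : ∀ x, |ψ x| ≤ U) {T : ℝ} (hT : T ∈ Icc (0 : ℝ) 1) :
    ∫ x, ψ (X.map x T) ∂μ = ∫ x, ψ (Y.map x T) ∂μ := by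
  obtain ⟨c, N, hcut⟩ := exists_cutoff d
  have hpos : ∀ n : ℕ, (0 : ℝ) < ((n + 1 : ℕ) : ℝ) := fun n => by positivity
  choose χ hχ hχ1 hχin hχout using fun n : ℕ => hcut ((n + 1 : ℕ) : ℝ) (hpos n)
  set q := (∫ p, ‖v (X.map p.1 p.2) p.2‖ ∂(timeProd μ))
    + ∫ p, ‖v (Y.map p.1 p.2) p.2‖ ∂(timeProd μ)
  have hbound : ∀ n : ℕ, |(∫ x, χ n (X.map x T) * ψ (X.map x T) ∂μ)
      - ∫ x, χ n (Y.map x T) * ψ (Y.map x T) ∂μ| ≤ U * c * q / ((n + 1 : ℕ) : ℝ) := by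
    intro n
    obtain ⟨κ, hκ, hκ1, hκin, hκout⟩ := hcut (2 * ((n + 1 : ℕ) : ℝ)) (by positivity)
    obtain ⟨M, Λ, hM, hΛ, hwM, hwΛ⟩ := hv.exists_bounds_smul hκ hκ1 hκout
    have hwm : Measurable (Function.uncurry fun x t => κ x • v x t) :=
      (hκ.differentiable.continuous.measurable.comp measurable_fst).smul hv.1
    refine (hX.abs_integral_cutoff_sub_le hY (hχ n) (hχ1 n) hψ hU hΛ hM hwm hwM hwΛ
      (fun x t hx => ?_) hT).trans (le_of_eq (by ring))
    have : ‖x‖ ≤ 2 * ((n + 1 : ℕ) : ℝ) := by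
      by_contra! h
      exact hx (hχout n x h.le)
    simp only [hκin x this, one_smul]
  have hlim : ∀ Z : CharMap μ, Filter.Tendsto (fun n => ∫ x, χ n (Z.map x T) * ψ (Z.map x T) ∂μ)
      Filter.atTop (nhds (∫ x, ψ (Z.map x T) ∂μ)) := by
    intro Z
    have hm := Z.aestronglyMeasurable_map_time hT
    refine tendsto_integral_of_dominated_convergence (fun _ => U) (fun n => ?_)
      (integrable_const U) (fun n => ae_of_all _ fun x => ?_) (ae_of_all _ fun x => ?_)
    · exact ((hχ n).differentiable.continuous.mul
        hψ.differentiable.continuous).comp_aestronglyMeasurable hm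
    · rw [Real.norm_eq_abs, abs_mul]
      exact (mul_le_mul (hχ1 n _) (hU _) (abs_nonneg _) zero_le_one).trans_eq (one_mul U)
    · refine tendsto_const_nhds.congr' ?_
      obtain ⟨n₀, hn₀⟩ := exists_nat_ge ‖Z.map x T‖
      filter_upwards [Filter.eventually_ge_atTop n₀] with n hn
      have : ‖Z.map x T‖ ≤ ((n + 1 : ℕ) : ℝ) := hn₀.trans (by exact_mod_cast hn.trans n.le_succ)
      rw [hχin n _ this, one_mul]
  have h1 := ((hlim X).sub (hlim Y)).abs
  have h2 := (tendsto_const_div_atTop_nhds_zero_nat (U * c * q)).comp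
      (Filter.tendsto_add_atTop_nat 1)
  have h3 := le_of_tendsto_of_tendsto' h1 h2 hbound
  exact sub_eq_zero.1 (abs_nonpos_iff.1 h3)

theorem isC11_cos_inner {E : Type*} [NormedAddCommGroup E] [InnerProductSpace ℝ E] (ξ : E)
    (b : ℝ) : IsC11 (fun x : E => Real.cos (inner ℝ ξ x + b)) ‖ξ‖ (‖ξ‖ * ‖ξ‖) := by
  have hd : ∀ x : E, HasFDerivAt (fun x : E => Real.cos (inner ℝ ξ x + b))
      (-Real.sin (inner ℝ ξ x + b) • innerSL ℝ ξ) x := fun x =>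
    ((innerSL ℝ ξ).hasFDerivAt.add_const b).cos
  refine ⟨fun x => (hd x).differentiableAt, by positivity, fun x => ?_, fun x y => ?_⟩
  · rw [(hd x).fderiv, norm_smul, innerSL_apply_norm, norm_neg, Real.norm_eq_abs]
    exact mul_le_of_le_one_left (norm_nonneg _) (Real.abs_sin_le_one _)
  · rw [(hd x).fderiv, (hd y).fderiv, ← sub_smul, norm_smul, innerSL_apply_norm, mul_comm,
      mul_assoc]
    refine mul_le_mul_of_nonneg_left ?_ (norm_nonneg _)
    have h1 := Real.lipschitzWith_sin.dist_le_mul (inner ℝ ξ y + b) (inner ℝ ξ x + b)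
    rw [NNReal.coe_one, one_mul, Real.dist_eq, Real.dist_eq] at h1
    rw [Real.norm_eq_abs, neg_sub_neg]
    refine h1.trans ?_
    rw [add_sub_add_right_eq_sub, ← inner_sub_right, norm_sub_rev x]
    exact abs_real_inner_le_norm _ _

/-- Uniqueness for the continuity equation: the drift determines the law at every time. -/
theorem IsWeakDrift.map_eq {X Y : CharMap μ} {v : RR d → ℝ → RR d} (hv : IsRegularField v)
    (hX : IsWeakDrift X v) (hY : IsWeakDrift Y v) {T : ℝ} (hT : T ∈ Icc (0 : ℝ) 1) :
    μ.map (fun x => X.map x T) = μ.map (fun x => Y.map x T) := by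
  have hm : ∀ Z : CharMap μ, AEMeasurable (fun x => Z.map x T) μ := fun Z =>
    (Z.aestronglyMeasurable_map_time hT).aemeasurable
  have hp : ∀ Z : CharMap μ, IsProbabilityMeasure (μ.map (fun x => Z.map x T)) := fun Z =>
    Measure.isProbabilityMeasure_map (hm Z)
  have := hp X
  have := hp Y
  -- the sine is the cosine shifted by `-π / 2`
  refine Measure.ext_of_charFun (funext fun ξ => ?_)
  have hcf : ∀ Z : CharMap μ, charFun (μ.map (fun x => Z.map x T)) ξ
      = ((∫ x, Real.cos (inner ℝ ξ (Z.map x T) + 0) ∂μ : ℝ) : ℂ)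
        + ((∫ x, Real.cos (inner ℝ ξ (Z.map x T) + -(Real.pi / 2)) ∂μ : ℝ) : ℂ) * Complex.I := by
    intro Z
    have hi : ∀ b : ℝ, Integrable (fun x => Real.cos (inner ℝ ξ (Z.map x T) + b)) μ := fun b =>
      (integrable_const (1 : ℝ)).mono'
        ((isC11_cos_inner ξ b).differentiable.continuous.comp_aestronglyMeasurable
          (hm Z).aestronglyMeasurable) (ae_of_all _ fun x => Real.abs_cos_le_one _)
    rw [charFun_apply, integral_map (hm Z) (by fun_prop), ← integral_complex_ofReal,
      ← integral_complex_ofReal, ← integral_mul_const, ← integral_add (hi 0).ofReal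
      ((hi _).ofReal.mul_const _)]
    refine integral_congr_ae (ae_of_all _ fun x => ?_)
    simp only
    rw [Complex.exp_mul_I, real_inner_comm, ← sub_eq_add_neg, Real.cos_sub_pi_div_two, add_zero]
    push_cast
    rfl
  rw [hcf, hcf, hX.integral_eq hv hY (isC11_cos_inner ξ 0) (fun _ => Real.abs_cos_le_one _) hT,
    hX.integral_eq hv hY (isC11_cos_inner ξ _) (fun _ => Real.abs_cos_le_one _) hT]

/-- Space-time averages along two trajectories with the same laws agree. -/
theorem integral_comp_map_eq {X Y : CharMap μ}
    (h : ∀ t ∈ Icc (0 : ℝ) 1, μ.map (fun x => X.map x t) = μ.map (fun x => Y.map x t))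
    {f : RR d → ℝ → ℝ} (hf : Measurable (Function.uncurry f))
    (hX : Integrable (fun p : RR d × ℝ => f (X.map p.1 p.2) p.2) (timeProd μ))
    (hY : Integrable (fun p : RR d × ℝ => f (Y.map p.1 p.2) p.2) (timeProd μ)) :
    ∫ p, f (X.map p.1 p.2) p.2 ∂(timeProd μ) = ∫ p, f (Y.map p.1 p.2) p.2 ∂(timeProd μ) := by
  rw [integral_prod_symm _ hX, integral_prod_symm _ hY]
  refine setIntegral_congr_fun measurableSet_Icc fun t ht => ?_
  have hft : Measurable fun y => f y t := hf.comp measurable_prodMk_right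
  have e : ∀ Z : CharMap μ, ∫ x, f (Z.map x t) t ∂μ = ∫ y, f y t ∂(μ.map fun x => Z.map x t) :=
    fun Z => (integral_map (Z.aestronglyMeasurable_map_time ht).aemeasurable
      hft.aestronglyMeasurable).symm
  simp only [e, h t ht]

end LawEquality

/-! ### Descent of the cost -/

section Descent

variable {d : ℕ} {μ : Measure (RR d)} [IsProbabilityMeasure μ]

/-- Replacing a trajectory by the flow of its matched velocity field preserves the laws at all
times, hence the potential and the terminal cost, and does not increase the kinetic energy. -/
theorem cost_le_of_isFlowMatching (hμ : MemLp (fun x : RR d => x) 2 μ) {F G : RR d → ℝ}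
    {L : NNReal} (hF : IsLSmooth L F) (hG : IsLSmooth L G) {X Y : CharMap μ}
    {v : RR d → ℝ → RR d} (hv : IsRegularField v) (hX : SolvesODE X v) (hY : IsFlowMatching Y v) :
    cost F G X ≤ cost F G Y := by
  have hXd := hX.isWeakDrift hv.1
  have hYd := hY.isWeakDrift
  have hlaw : ∀ t ∈ Icc (0 : ℝ) 1, μ.map (fun x => X.map x t) = μ.map (fun x => Y.map x t) :=
    fun t ht => hXd.map_eq hv hYd ht
  have h1I : (1 : ℝ) ∈ Icc (0 : ℝ) 1 := ⟨zero_le_one, le_rfl⟩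
  have hFc := hF.1.continuous
  have hGc := hG.1.continuous
  have e1 : ∫ p, F (X.map p.1 p.2) ∂(timeProd μ) = ∫ p, F (Y.map p.1 p.2) ∂(timeProd μ) :=
    integral_comp_map_eq hlaw (f := fun x _ => F x) (hFc.measurable.comp measurable_fst)
      (hF.integrable_comp (X.memLp_map hμ)) (hF.integrable_comp (Y.memLp_map hμ))
  have e2 : ∫ x, G (X.map x 1) ∂μ = ∫ x, G (Y.map x 1) ∂μ := by
    have e : ∀ Z : CharMap μ, ∫ x, G (Z.map x 1) ∂μ = ∫ y, G y ∂(μ.map fun x => Z.map x 1) :=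
      fun Z => (integral_map (Z.aestronglyMeasurable_map_time h1I).aemeasurable
        hGc.aestronglyMeasurable).symm
    rw [e, e, hlaw 1 h1I]
  have e3 : ∫ p, ‖X.vel p.1 p.2‖ ^ 2 ∂(timeProd μ) ≤ ∫ p, ‖Y.vel p.1 p.2‖ ^ 2 ∂(timeProd μ) := by
    calc ∫ p, ‖X.vel p.1 p.2‖ ^ 2 ∂(timeProd μ)
        = ∫ p, ‖v (X.map p.1 p.2) p.2‖ ^ 2 ∂(timeProd μ) := by
          refine integral_congr_ae ?_
          filter_upwards [hX.ae_eq hv.1] with p hp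
          rw [hp]
      _ = ∫ p, ‖v (Y.map p.1 p.2) p.2‖ ^ 2 ∂(timeProd μ) :=
          integral_comp_map_eq hlaw (f := fun x t => ‖v x t‖ ^ 2) (hv.1.norm.pow_const 2)
            (hXd.memLp.integrable_norm_pow (by norm_num))
            (hYd.memLp.integrable_norm_pow (by norm_num))
      _ ≤ _ := hYd.integral_norm_sq_le
  rw [cost_eq hμ hF hG, cost_eq hμ hF hG, e1, e2]
  linarith

theorem IsSchemeSequence.sum_distSq_le (hμ : MemLp (fun x : RR d => x) 2 μ) {F G : RR d → ℝ}
    {L : NNReal} (hF : IsLSmooth L F) (hG : IsLSmooth L G) {α : ℝ} {X Xh : ℕ → CharMap μ}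
    {v : ℕ → RR d → ℝ → RR d} (h : IsSchemeSequence F G α X Xh v)
    (hv : ∀ l, IsRegularField (v l)) (n : ℕ) :
    cost F G (X n) + 1 / (2 * α) * ∑ l ∈ Finset.range n, distSq (Xh l) (X l)
      ≤ cost F G (X 0) := by
  induction n with
  | zero => simp
  | succ n ih =>
    have h1 := h.particle n (X n)
    rw [distSq_self, mul_zero, add_zero] at h1
    have h2 := cost_le_of_isFlowMatching hμ hF hG (hv (n + 1)) (h.resample (n + 1))
      (h.flowMatching n)
    rw [Finset.sum_range_succ, mul_add]
    linarith

end Descent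

theorem theorem2 {d : ℕ} (μ : Measure (RR d)) [IsProbabilityMeasure μ]
    (hμ : MemLp (fun x : RR d => x) 2 μ)
    (F G : RR d → ℝ) (L : NNReal) (hF : IsLSmooth L F) (hG : IsLSmooth L G)
    (α : ℝ) (hα : 0 < α) (hαL : α < 1 / (L : ℝ)) :
    (∀ (X Xh : ℕ → CharMap μ) (v : ℕ → RR d → ℝ → RR d) (Jlow : ℝ),
      IsSchemeSequence F G α X Xh v →
      (∀ l, IsRegularField (v l)) →
      (∀ Z : CharMap μ, Jlow ≤ cost F G Z) →
      ∀ K : ℕ, 1 ≤ K →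
        (Finset.range (K + 1)).inf' Finset.nonempty_range_add_one (fun l => distSq (Xh l) (X l))
          ≤ 2 * α * (cost F G (X 0) - Jlow) / K) ∧
    (∀ (lam : ℝ), 0 < lam → StrongConvexOn Set.univ lam F → StrongConvexOn Set.univ lam G →
      ∀ Xs : CharMap μ, (∀ Z : CharMap μ, cost F G Xs ≤ cost F G Z) →
      ∀ X : ℕ → CharMap μ, (∀ l, IsParticleUpdate F G α (X l) (X (l + 1))) →
      ∀ l : ℕ, distSq (X l) Xs ≤ 1 / (1 + 2 * lam * α) ^ l * distSq (X 0) Xs) := by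
  refine ⟨fun X Xh v Jlow hS hv hJ K hK => ?_, fun lam hlam hFc hGc Xs hXs X hX l =>
    IsParticleUpdate.distSq_le_geometric hμ hF hG hα hlam hFc hGc hXs hX l⟩
  have hK0 : (0 : ℝ) < K := by exact_mod_cast hK
  set m := (Finset.range (K + 1)).inf' Finset.nonempty_range_add_one
    (fun l => distSq (Xh l) (X l))
  have h1 := hS.sum_distSq_le hμ hF hG hv K
  have h2 : (K : ℝ) * m ≤ ∑ l ∈ Finset.range K, distSq (Xh l) (X l) := by
    have := Finset.card_nsmul_le_sum (Finset.range K) (fun l => distSq (Xh l) (X l)) m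
      fun l hl => Finset.inf'_le (fun l => distSq (Xh l) (X l))
        (Finset.range_subset_range.2 K.le_succ hl)
    simpa using this
  have h3 := hJ (X K)
  rw [le_div_iff₀ hK0]
  have h4 : 1 / (2 * α) * (K * m) ≤ cost F G (X 0) - Jlow := by
    have := mul_le_mul_of_nonneg_left h2 (by positivity : 0 ≤ 1 / (2 * α))
    linarith
  have h5 := mul_le_mul_of_nonneg_left h4 (by positivity : 0 ≤ 2 * α)
  have e : 2 * α * (1 / (2 * α) * (K * m)) = m * K := by field_simp
  rwa [e] at h5
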